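/- Let $k$ be a field of characteristic $p>0$. A variety over $k$ is an integral scheme that is separated and of finite type over $k$. Let $X$ be a variety over $k$ such that $k$ is algebraically closed in the function field $K(X)$. An elemental extension of $(k,X)$ is a pair $(k\subset l\subset k',\ \varphi:X'\to X)$ consisting of field extensions $k\subset l\subset k'$ and a morphism of schemes $\varphi$ such that: $k\subset l$ is purely inseparable with $l^p\subset k$, and $X\times_k l$ is an integral scheme; $X'$ is the normalisation of $X\times_k l$, and $\varphi$ is the induced morphism $X'\to X\times_k l\to X$; and $k'$ is the algebraic closure of $l$ in $K(X')$. In particular $X'$ is a scheme over $k'$. Let $(k\subset l\subset k',\ \varphi:X'\to X)$ be an elemental extension of $(k,X)$ and let $k\subset k_1$ be a (not necessarily algebraic) separable field extension, i.e. $F\otimes_k k_1$ is reduced for every field extension $k\subset F$. Set $l_1:=l\otimes_k k_1$, $k_1':=k'\otimes_k k_1$, $X_1:=X\times_k k_1$, $X_1':=X'\times_k k_1$, and let $\varphi_1:X_1'\to X_1$ be the morphism induced by $\varphi$. Then the following hold. 1. $X_1$ is a variety over $k_1$ such that $k_1$ is algebraically closed in $K(X_1)$. Furthermore, if $X$ is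 normal, then $X_1$ is normal. 2. $l_1$ and $k_1'$ are fields. The induced ring extensions $k_1\subset l_1\subset k_1'$ are purely inseparable field extensions such that $(k_1')^p\subset k_1$. 3. $[l_1:k_1]=[l:k]$, $[k_1':l_1]=[k':l]$ and $[k_1':k_1]=[k':k]$ (as cardinal numbers). 4. $(k_1\subset l_1\subset k_1',\ \varphi_1:X_1'\to X_1)$ is an elemental extension of $(k_1,X_1)$. -/

import Mathlib

open CategoryTheory CategoryTheory.Limits AlgebraicGeometry
open scoped TensorProduct

universe u

namespace ElementalExt

noncomputable section

/-! ### Field extensions -/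

/-- A (not necessarily algebraic) field extension `K / k` is separable if `F ⊗[k] K` is reduced
for every field extension `F / k`. -/
def IsSeparableExtension (k K : Type u) [Field k] [Field K] [Algebra k K] : Prop :=
  ∀ (F : Type u) [Field F] [Algebra k F], IsReduced (F ⊗[k] K)

/-- The extension of rings given by a ring homomorphism `i` is purely inseparable. -/
def IsPurelyInseparableHom {R S : Type u} [CommRing R] [CommRing S] (i : R →+* S) : Prop :=
  letI : Algebra R S := i.toAlgebra
  IsPurelyInseparable R S

/-- The degree `[S : R]`, as a cardinal, of the extension given by `i : R → S`. -/
def degree {R S : Type u} [CommRing R] [CommRing S] (i : R →+* S) : Cardinal.{u} :=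
  letI : Algebra R S := i.toAlgebra
  Module.rank R S

/-- The element `x` of `S` is algebraic over `R` via `i : R → S`. -/
def IsAlgebraicElem {R S : Type u} [CommRing R] [CommRing S] (i : R →+* S) (x : S) : Prop :=
  letI : Algebra R S := i.toAlgebra
  IsAlgebraic R x

/-! ### Schemes over a ring -/

/-- The morphism `Spec S ⟶ Spec R` induced by a ring homomorphism `R → S`. -/
abbrev specMap {R S : Type u} [CommRing R] [CommRing S] (i : R →+* S) :
    Spec (CommRingCat.of S) ⟶ Spec (CommRingCat.of R) :=
  Spec.map (CommRingCat.ofHom i)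

/-- The homomorphism `R → K(X)` given by a morphism `X ⟶ Spec R` with `X` integral. -/
def toFunctionField {R : Type u} [CommRing R] {X : Scheme.{u}} [IsIntegral X]
    (α : X ⟶ Spec (CommRingCat.of R)) : R →+* X.functionField :=
  ((Scheme.ΓSpecIso (CommRingCat.of R)).inv ≫ α.appTop ≫ X.presheaf.germ ⊤ (genericPoint X) trivial).hom

/-- A variety over a field `k`: an integral scheme, separated and of finite type over `k`. -/
structure IsVariety {k : Type u} [Field k] {X : Scheme.{u}}
    (α : X ⟶ Spec (CommRingCat.of k)) : Prop where
  isIntegral : IsIntegral X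
  isSeparated : IsSeparated α
  locallyOfFiniteType : LocallyOfFiniteType α
  quasiCompact : QuasiCompact α

/-- The scheme `X` over `k` is integral and `k` is algebraically closed in `K(X)`. -/
structure IsAlgClosedInFunctionField {k : Type u} [Field k] {X : Scheme.{u}}
    (α : X ⟶ Spec (CommRingCat.of k)) : Prop where
  [isIntegral : IsIntegral X]
  mem_range : ∀ x : X.functionField,
    IsAlgebraicElem (toFunctionField α) x → x ∈ (toFunctionField α).range

/-- A scheme is normal if all its local rings are integrally closed domains. -/
def IsNormal (X : Scheme.{u}) : Prop :=
  ∀ x : X, IsDomain (X.presheaf.stalk x) ∧ IsIntegrallyClosed (X.presheaf.stalk x)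

/-- The morphism `ν : Y ⟶ Z` is the normalisation of the integral scheme `Z`: the scheme `Y` is
integral and normal, and `ν` is integral and birational. -/
structure IsNormalization {Y Z : Scheme.{u}} (ν : Y ⟶ Z) : Prop where
  [isIntegral_source : IsIntegral Y]
  [isIntegral_target : IsIntegral Z]
  isNormal : IsNormal Y
  isIntegralHom : IsIntegralHom ν
  map_genericPoint : ν (genericPoint Y) = genericPoint Z
  isIso_stalkMap : IsIso (ν.stalkMap (genericPoint Y))

/-! ### Elemental extensions -/

/-- Let `α : X ⟶ Spec k` be a variety such that `k` is algebraically closed in `K(X)`, with `k` of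
characteristic `p > 0`. Then `(k ⊂ l ⊂ k', φ : X' ⟶ X)` is an elemental extension of `(k, X)`.
The inclusions of fields are `i` and `j`, and the inclusion of `k'` in `K(X')` is the one given by
the structure morphism `α' : X' ⟶ Spec k'`. -/
structure IsElementalExtension (p : ℕ) {k l k' : Type u} [Field k] [CommRing l] [CommRing k']
    (i : k →+* l) (j : l →+* k') {X X' : Scheme.{u}} (α : X ⟶ Spec (CommRingCat.of k))
    (α' : X' ⟶ Spec (CommRingCat.of k')) (φ : X' ⟶ X) : Prop where
  isField_left : IsField l
  isField_right : IsField k'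
  isPurelyInseparable : IsPurelyInseparableHom i
  pow_mem_range : ∀ x : l, x ^ p ∈ i.range
  isIntegral_baseChange : IsIntegral (pullback α (specMap i))
  /-- The square formed by `φ`, `α`, `α'` and `Spec k' ⟶ Spec k` commutes. -/
  comm : φ ≫ α = α' ≫ specMap (j.comp i)
  /-- The morphism `X' ⟶ X ×ₖ l` with components `φ` and `X' ⟶ Spec k' ⟶ Spec l` is the
  normalisation of `X ×ₖ l`. -/
  isNormalization : IsNormalization
    (pullback.lift φ (α' ≫ specMap j) (by simp [comm, specMap]) : X' ⟶ pullback α (specMap i))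
  /-- The field `k'` is the algebraic closure of `l` in `K(X')`. -/
  isAlgebraicElem_iff :
    haveI : IsIntegral X' := isNormalization.isIntegral_source
    ∀ x : X'.functionField,
      IsAlgebraicElem ((toFunctionField α').comp j) x ↔ x ∈ (toFunctionField α').range

/-! ### Base change along `k → k₁` -/

section BaseChange

variable {k : Type u} [Field k] (k₁ : Type u) [Field k₁] [Algebra k k₁]

/-- The scheme `X ×ₖ k₁`. -/
abbrev baseChange {X : Scheme.{u}} (α : X ⟶ Spec (CommRingCat.of k)) : Scheme.{u} :=
  pullback α (specMap (algebraMap k k₁))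

/-- The projection `X ×ₖ k₁ ⟶ Spec k₁`. -/
abbrev baseChangeStr {X : Scheme.{u}} (α : X ⟶ Spec (CommRingCat.of k)) :
    baseChange k₁ α ⟶ Spec (CommRingCat.of k₁) :=
  pullback.snd α (specMap (algebraMap k k₁))

/-- The morphism `X' ×ₖ k₁ ⟶ X ×ₖ k₁` induced by `φ : X' ⟶ X`. -/
abbrev baseChangeMap {X X' : Scheme.{u}} (α : X ⟶ Spec (CommRingCat.of k)) (φ : X' ⟶ X) :
    baseChange k₁ (φ ≫ α) ⟶ baseChange k₁ α :=
  pullback.map (φ ≫ α) (specMap (algebraMap k k₁)) α (specMap (algebraMap k k₁)) φ (𝟙 _) (𝟙 _)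
    (by simp) (by simp)

/-- The morphism `X' ×ₖ k₁ ⟶ Spec k' ×ₖ k₁ = Spec (k' ⊗ₖ k₁)` induced by `α' : X' ⟶ Spec k'`. -/
abbrev baseChangeTop {k' : Type u} [Field k'] [Algebra k k'] {X' : Scheme.{u}}
    (β : X' ⟶ Spec (CommRingCat.of k)) (α' : X' ⟶ Spec (CommRingCat.of k'))
    (h : β = α' ≫ specMap (algebraMap k k')) :
    baseChange k₁ β ⟶ Spec (CommRingCat.of (k' ⊗[k] k₁)) :=
  pullback.map β (specMap (algebraMap k k₁)) (specMap (algebraMap k k'))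
    (specMap (algebraMap k k₁)) α' (𝟙 _) (𝟙 _) (by simp [h]) (by simp) ≫
    (pullbackSpecIso k k' k₁).hom

/-- The homomorphism `k₁ → A ⊗ₖ k₁`. -/
abbrev inclRight (A : Type u) [CommRing A] [Algebra k A] : k₁ →+* A ⊗[k] k₁ :=
  (Algebra.TensorProduct.includeRight : k₁ →ₐ[k] A ⊗[k] k₁).toRingHom

/-- The homomorphism `l ⊗ₖ k₁ → k' ⊗ₖ k₁` induced by `l → k'`. -/
abbrev tensorMap (l k' : Type u) [CommRing l] [CommRing k'] [Algebra k l] [Algebra k k']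
    [Algebra l k'] [IsScalarTower k l k'] : l ⊗[k] k₁ →+* k' ⊗[k] k₁ :=
  (Algebra.TensorProduct.map (IsScalarTower.toAlgHom k l k') (AlgHom.id k k₁)).toRingHom

end BaseChange

end

end ElementalExt
open ElementalExt

/-!
An algebra `K` over `k` is thought of as good if base change along `k → K` sends integrally closed
ring homomorphisms to integrally closed ones. Smooth algebras and localisations are good, hence so
is a finitely generated separable field extension, which is finite separable over a purely
transcendental one; an arbitrary separable extension is the union of its finitely generated
subextensions. If `k` is integrally closed in a normal domain `A`, it follows that `k₁ ⊗ A` is a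
normal domain in whose field of fractions `k₁` is integrally closed. On affine opens this is the
claim about `X₁`.

The `p`-th power of a function on `X' → X ×ₖ l` comes from `K(X)`, so the `p`-th power of an element
of `k'` is algebraic over `k` in `K(X)` and lies in `k`. A reduced ring such as `k' ⊗ k₁` whose
`p`-th powers lie in the field `k₁` is itself a field. Since `k'` is algebraic over `k`, the
`k'`-algebra `k' ⊗ k₁` is again separable, and the argument for `X₁` applies to
`X₁' = X' ×_{k'} (k' ⊗ k₁)`.
-/

namespace ElementalExt

/-! ### Integrally closed ring homomorphisms -/

/-- `R` is integrally closed in `B` via `f : R → B`, in the sense that every element of `B` that is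
integral over `R` comes from `R`. In contrast to `IsIntegrallyClosedIn`, the homomorphism `f` need
not be injective. -/
def IsIntegrallyClosedHom {R B : Type*} [CommRing R] [CommRing B] (f : R →+* B) : Prop :=
  ∀ x : B, f.IsIntegralElem x → x ∈ f.range

namespace IsIntegrallyClosedHom

variable {R S T : Type*} [CommRing R] [CommRing S] [CommRing T]

lemma comp {g : S →+* T} {f : R →+* S} (hg : IsIntegrallyClosedHom g)
    (hf : IsIntegrallyClosedHom f) (hinj : Function.Injective g) :
    IsIntegrallyClosedHom (g.comp f) := by
  intro x hx
  obtain ⟨y, rfl⟩ := hg x hx.of_comp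
  obtain ⟨z, rfl⟩ := hf y (hx.of_map hinj)
  exact ⟨z, rfl⟩

lemma of_comp {g : S →+* T} {f : R →+* S} (h : IsIntegrallyClosedHom (g.comp f))
    (hinj : Function.Injective g) : IsIntegrallyClosedHom f := by
  intro x hx
  obtain ⟨r, hr⟩ := h (g x) (hx.map g)
  exact ⟨r, hinj hr⟩

lemma of_ringEquiv {R' S' : Type*} [CommRing R'] [CommRing S'] {f : R →+* S} {f' : R' →+* S'}
    (e : R ≃+* R') (e' : S ≃+* S') (h : f'.comp e.toRingHom = e'.toRingHom.comp f)
    (hf : IsIntegrallyClosedHom f) : IsIntegrallyClosedHom f' := by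
  have hsymm : e'.symm.toRingHom.comp f' = f.comp e.symm.toRingHom := by
    ext x
    apply e'.injective
    simpa using congr($h (e.symm x))
  intro x hx
  have hx' := hx.map e'.symm.toRingHom
  rw [hsymm] at hx'
  obtain ⟨y, hy⟩ := hf _ hx'.of_comp
  exact ⟨e y, congr($h y).trans (by simp [hy])⟩

lemma of_surjective_toIntegralClosure [Algebra R S] [Algebra R T]
    (h : Function.Surjective (TensorProduct.toIntegralClosure R S T))
    (hf : IsIntegrallyClosedHom (algebraMap R T)) :
    IsIntegrallyClosedHom (algebraMap S (S ⊗[R] T)) := by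
  intro x hx
  obtain ⟨w, hw⟩ := h ⟨x, hx⟩
  obtain rfl : (TensorProduct.toIntegralClosure R S T w : S ⊗[R] T) = x := congrArg Subtype.val hw
  clear hw hx
  induction w with
  | zero => simp
  | add a b ha hb => simpa using add_mem ha hb
  | tmul s b =>
    obtain ⟨r, hr⟩ := hf b.1 b.2
    refine ⟨r • s, ?_⟩
    simp [TensorProduct.toIntegralClosure, ← hr, Algebra.algebraMap_eq_smul_one,
      Algebra.TensorProduct.one_def, TensorProduct.smul_tmul']

end IsIntegrallyClosedHom

/-- Base change along `k → S` preserves integrally closed homomorphisms of `k`-algebras. -/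
def PreservesIntegralClosedness (k S : Type u) [CommRing k] [CommRing S] [Algebra k S] : Prop :=
  ∀ (R B : Type u) [CommRing R] [CommRing B] [Algebra k R] [Algebra k B] (f : R →ₐ[k] B),
    IsIntegrallyClosedHom f.toRingHom →
      IsIntegrallyClosedHom (Algebra.TensorProduct.map (AlgHom.id k S) f).toRingHom

namespace PreservesIntegralClosedness

section

variable (k S : Type u) [CommRing k] [CommRing S] [Algebra k S]

lemma of_surjective_toIntegralClosure
    (h : ∀ (R B : Type u) [CommRing R] [CommRing B] [Algebra k R] [Algebra R B],
      Function.Surjective (TensorProduct.toIntegralClosure R (R ⊗[k] S) B)) :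
    PreservesIntegralClosedness k S := by
  intro R B _ _ _ _ f hf
  let := f.toRingHom.toAlgebra
  have : IsScalarTower k R B := .of_algebraMap_eq' f.comp_algebraMap.symm
  let e : (R ⊗[k] S) ⊗[R] B ≃ₐ[k] S ⊗[k] B :=
    (((Algebra.TensorProduct.comm R (R ⊗[k] S) B).restrictScalars k).trans
      ((Algebra.TensorProduct.cancelBaseChange k R R B S).restrictScalars k)).trans
      (Algebra.TensorProduct.comm k B S)
  refine (IsIntegrallyClosedHom.of_surjective_toIntegralClosure (h R B) hf).of_ringEquiv
    (Algebra.TensorProduct.comm k R S).toRingEquiv e.toRingEquiv ?_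
  have hfB (r : R) : algebraMap R B r = f r := rfl
  ext x <;> simp [e, hfB, Algebra.TensorProduct.algebraMap_apply, Algebra.smul_def]

lemma of_smooth [Algebra.Smooth k S] : PreservesIntegralClosedness k S :=
  of_surjective_toIntegralClosure k S fun _ _ ↦
    TensorProduct.toIntegralClosure_bijective_of_smooth.surjective

lemma of_isLocalization (M : Submonoid k) [IsLocalization M S] : PreservesIntegralClosedness k S :=
  of_surjective_toIntegralClosure k S fun R _ _ _ _ _ ↦
    (TensorProduct.toIntegralClosure_bijective_of_isLocalization
      (Algebra.algebraMapSubmonoid R M)).surjective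

end

section

variable {k S T : Type u} [CommRing k] [CommRing S] [CommRing T] [Algebra k S] [Algebra k T]

lemma trans [Algebra S T] [IsScalarTower k S T] (h₁ : PreservesIntegralClosedness k S)
    (h₂ : PreservesIntegralClosedness S T) : PreservesIntegralClosedness k T := by
  intro R B _ _ _ _ f hf
  refine (h₂ (S ⊗[k] R) (S ⊗[k] B) (Algebra.TensorProduct.map (AlgHom.id S S) f)
    (h₁ R B f hf)).of_ringEquiv
      (Algebra.TensorProduct.cancelBaseChange k S S T R).toRingEquiv
      (Algebra.TensorProduct.cancelBaseChange k S S T B).toRingEquiv ?_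
  ext x <;> simp [Algebra.TensorProduct.one_def]

lemma isIntegrallyClosedHom_algebraMap (hS : PreservesIntegralClosedness k S)
    (hT : IsIntegrallyClosedHom (algebraMap k T)) :
    IsIntegrallyClosedHom (algebraMap S (S ⊗[k] T)) := by
  refine (hS k T (Algebra.ofId k T) hT).of_ringEquiv
    (Algebra.TensorProduct.rid k S S).toRingEquiv (RingEquiv.refl _) ?_
  ext x <;> simp [Algebra.TensorProduct.one_def, Algebra.algebraMap_eq_smul_one,
    TensorProduct.smul_tmul']

end

end PreservesIntegralClosedness

/-! ### Geometrically reduced field extensions -/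

lemma IsSeparableExtension.isGeometricallyReduced {k K : Type u} [Field k] [Field K] [Algebra k K]
    (h : IsSeparableExtension k K) : Algebra.IsGeometricallyReduced k K :=
  (Algebra.isGeometricallyReduced_field_iff k K).mpr (h (AlgebraicClosure k))

section

variable (k K : Type*) [Field k]

lemma isGeometricallyReduced_tensorProduct_of_isAlgebraic [CommRing K] [Algebra k K]
    [Algebra.IsGeometricallyReduced k K] (k' : Type*) [Field k'] [Algebra k k']
    [Algebra.IsAlgebraic k k'] : Algebra.IsGeometricallyReduced k' (k' ⊗[k] K) := by
  have : Algebra.IsAlgebraic k (AlgebraicClosure k') := .trans k k' _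
  exact (Algebra.isGeometricallyReduced_field_iff k' _).mpr
    (isReduced_of_injective _ (Algebra.TensorProduct.cancelBaseChange k k' k'
      (AlgebraicClosure k') K).injective)

variable [Field K] [Algebra k K] [Algebra.IsGeometricallyReduced k K]

variable {K} in
/-- Over the algebraic closure, the `p`-th power of `∑ cᵢ^(1/p) ⊗ xᵢ` is `1 ⊗ ∑ cᵢ xᵢ ^ p`. -/
lemma linearIndepOn_pow_of_isGeometricallyReduced (p : ℕ) [Fact p.Prime] [CharP k p]
    (s : Finset K) (hs : LinearIndepOn k id (s : Set K)) :
    LinearIndepOn k (· ^ p) (s : Set K) := by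
  let F := AlgebraicClosure k
  have : CharP (F ⊗[k] K) p := charP_of_injective_algebraMap (algebraMap k _).injective p
  have hs' : LinearIndependent F fun x : (s : Set K) ↦ (1 : F) ⊗ₜ[k] (x : K) :=
    Module.Flat.linearIndependent_one_tmul hs
  rw [LinearIndepOn, Fintype.linearIndependent_iff]
  intro c hc i
  choose d hd using fun i ↦ IsAlgClosed.exists_pow_nat_eq (algebraMap k F (c i))
    (Fact.out : p.Prime).pos
  have hpow : (∑ i : (s : Set K), d i • (1 : F) ⊗ₜ[k] (i : K)) ^ p = 0 := by
    have hterm (i : (s : Set K)) :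
        (d i • (1 : F) ⊗ₜ[k] (i : K)) ^ p = 1 ⊗ₜ (c i • (i : K) ^ p) := by
      rw [smul_pow, hd, Algebra.TensorProduct.tmul_pow, one_pow, algebraMap_smul,
        TensorProduct.tmul_smul]
    rw [sum_pow_char, Finset.sum_congr rfl fun i _ ↦ hterm i, ← TensorProduct.tmul_sum, hc,
      TensorProduct.tmul_zero]
  have hdi : d i = 0 := Fintype.linearIndependent_iff.mp hs' d (eq_zero_of_pow_eq_zero hpow) i
  simpa [hdi, (Fact.out : p.Prime).ne_zero] using (hd i).symm

lemma exists_isTranscendenceBasis_and_isSeparable_of_isGeometricallyReduced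
    [Algebra.EssFiniteType k K] :
    ∃ s : Finset K, IsTranscendenceBasis k ((↑) : s → K) ∧
      Algebra.IsSeparable (IntermediateField.adjoin k (s : Set K)) K := by
  obtain _ | ⟨p, hp, _⟩ := CharP.exists' k
  · exact exists_isTranscendenceBasis_and_isSeparable_of_perfectField k K
  · have : ExpChar k p := .prime hp.out
    exact exists_isTranscendenceBasis_and_isSeparable_of_linearIndepOn_pow_of_essFiniteType p
      hp.out (linearIndepOn_pow_of_isGeometricallyReduced k p)

lemma exists_finite_isSeparable_adjoin_of_isGeometricallyReduced [Algebra.EssFiniteType k K] :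
    ∃ s : Finset K, AlgebraicIndependent k ((↑) : s → K) ∧
      Algebra.IsSeparable (IntermediateField.adjoin k (s : Set K)) K ∧
      Module.Finite (IntermediateField.adjoin k (s : Set K)) K := by
  obtain ⟨s, hs, hsep⟩ :=
    exists_isTranscendenceBasis_and_isSeparable_of_isGeometricallyReduced k K
  have : Algebra.EssFiniteType (IntermediateField.adjoin k (s : Set K)) K := .of_comp k _ _
  exact ⟨s, hs.1, hsep, Algebra.finite_of_essFiniteType_of_isAlgebraic⟩

end

section

variable {k K : Type u} [Field k] [Field K] [Algebra k K]

open scoped IntermediateField.algebraAdjoinAdjoin in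
lemma PreservesIntegralClosedness.adjoin {s : Set K} [Finite s]
    (hs : AlgebraicIndependent k ((↑) : s → K)) :
    PreservesIntegralClosedness k (IntermediateField.adjoin k s) := by
  have : Algebra.Smooth k (MvPolynomial s k) := ⟨inferInstance, inferInstance⟩
  let e : MvPolynomial s k ≃ₐ[k] Algebra.adjoin k s :=
    hs.aevalEquiv.trans (Subalgebra.equivOfEq _ _ (by rw [Subtype.range_coe]))
  have : Algebra.Smooth k (Algebra.adjoin k s) := .of_equiv e
  exact (of_smooth k (Algebra.adjoin k s)).trans
    (.of_isLocalization _ _ (nonZeroDivisors (Algebra.adjoin k s)))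

variable (k K) in
lemma smooth_of_isSeparable [Algebra.IsSeparable k K] [Module.Finite k K] : Algebra.Smooth k K := by
  have : Algebra.FormallyEtale k K := .of_isSeparable k K
  have : Algebra.FinitePresentation k K := Algebra.FinitePresentation.of_finiteType.mp inferInstance
  exact {}

lemma PreservesIntegralClosedness.of_essFiniteType [Algebra.IsGeometricallyReduced k K]
    [Algebra.EssFiniteType k K] : PreservesIntegralClosedness k K := by
  obtain ⟨s, hs, _, _⟩ := exists_finite_isSeparable_adjoin_of_isGeometricallyReduced k K
  have := smooth_of_isSeparable (IntermediateField.adjoin k (s : Set K)) K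
  exact (PreservesIntegralClosedness.adjoin hs).trans (.of_smooth _ _)

end

/-! ### Descent to finitely generated subextensions -/

section

variable {k K : Type*} [Field k] [Field K] [Algebra k K] (R : Type*) [CommRing R] [Algebra k R]

/-- The inclusion `E ⊗ R → K ⊗ R` for an intermediate field `E` of `K / k`. -/
noncomputable abbrev inclTensor (E : IntermediateField k K) : E ⊗[k] R →ₐ[k] K ⊗[k] R :=
  Algebra.TensorProduct.map E.val (AlgHom.id k R)

lemma inclTensor_injective (E : IntermediateField k K) : Function.Injective (inclTensor R E) :=
  Module.Flat.rTensor_preserves_injective_linearMap E.val.toLinearMap E.val.injective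

variable {R} in
lemma exists_fg_forall_mem_range_inclTensor (t : Finset (K ⊗[k] R)) :
    ∃ E₀ : IntermediateField k K, E₀.FG ∧
      ∀ E ≥ E₀, ∀ x ∈ t, x ∈ (inclTensor R E).range := by
  obtain ⟨M, hM, htM⟩ :=
    TensorProduct.exists_finite_submodule_left_of_setFinite _ t.finite_toSet
  obtain ⟨s, rfl⟩ := Module.Finite.iff_fg.mp hM
  refine ⟨IntermediateField.adjoin k s, ⟨s, rfl⟩, fun E hE x hx ↦ ?_⟩
  have hsE : Submodule.span k s ≤ E.toSubalgebra.toSubmodule :=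
    Submodule.span_le.mpr (IntermediateField.adjoin_le_iff.mp hE)
  obtain ⟨y, rfl⟩ := htM hx
  refine ⟨(Submodule.inclusion hsE).rTensor R y, ?_⟩
  change ((E.toSubalgebra.toSubmodule.subtype.rTensor R) ∘ₗ _) y = _
  rw [← LinearMap.rTensor_comp]
  rfl

variable {R} in
lemma exists_fg_forall_mem_lifts_inclTensor (P : Polynomial (K ⊗[k] R)) :
    ∃ E₀ : IntermediateField k K, E₀.FG ∧
      ∀ E ≥ E₀, P ∈ Polynomial.lifts (inclTensor R E).toRingHom := by
  obtain ⟨E₀, hfg, hE₀⟩ := exists_fg_forall_mem_range_inclTensor P.coeffs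
  refine ⟨E₀, hfg, fun E hE ↦ (Polynomial.lifts_iff_coeff_lifts P).mpr fun n ↦ ?_⟩
  by_cases hn : P.coeff n = 0
  · exact hn ▸ ⟨0, map_zero _⟩
  · exact hE₀ E hE _ (Polynomial.coeff_mem_coeffs hn)

end

theorem PreservesIntegralClosedness.of_isGeometricallyReduced (k K : Type u) [Field k] [Field K]
    [Algebra k K] [Algebra.IsGeometricallyReduced k K] : PreservesIntegralClosedness k K := by
  rintro R B _ _ _ _ f hf x ⟨P, hP, hPx⟩
  obtain ⟨E₁, hE₁, hx⟩ := exists_fg_forall_mem_range_inclTensor {x}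
  obtain ⟨E₂, hE₂, hPE⟩ := exists_fg_forall_mem_lifts_inclTensor P
  obtain ⟨E, hE, hle₁, hle₂⟩ : ∃ E : IntermediateField k K, E.FG ∧ E₁ ≤ E ∧ E₂ ≤ E :=
    ⟨E₁ ⊔ E₂, IntermediateField.fg_sup hE₁ hE₂, le_sup_left, le_sup_right⟩
  obtain ⟨y, rfl⟩ := hx E hle₁ x (Finset.mem_singleton_self x)
  obtain ⟨Q, rfl, -, hQ⟩ := Polynomial.lifts_and_natDegree_eq_and_monic (hPE E hle₂) hP
  have : Algebra.EssFiniteType k E := IntermediateField.essFiniteType_iff.mpr hE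
  have : Algebra.IsGeometricallyReduced k E := .of_injective E.val E.val.injective
  have hcomm : (Algebra.TensorProduct.map (AlgHom.id k K) f).toRingHom.comp
      (inclTensor R E).toRingHom = (inclTensor B E).toRingHom.comp
        (Algebra.TensorProduct.map (AlgHom.id k E) f).toRingHom := by
    ext x <;> simp
  have hy : (Algebra.TensorProduct.map (AlgHom.id k E) f).toRingHom.IsIntegralElem y :=
    ⟨Q, hQ, inclTensor_injective B E (by
      rw [map_zero, ← hPx, Polynomial.eval₂_map, hcomm, ← Polynomial.hom_eval₂]; rfl)⟩
  obtain ⟨z, rfl⟩ := PreservesIntegralClosedness.of_essFiniteType R B f hf y hy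
  exact ⟨inclTensor R E z, congr($hcomm z)⟩

/-! ### Normal domains -/

/-- The ring `A` is a normal domain, i.e. a domain that is integrally closed in its field of
fractions. -/
structure IsNormalDomain (A : Type*) [CommRing A] : Prop where
  isDomain : IsDomain A
  isIntegrallyClosed : IsIntegrallyClosed A

lemma isIntegrallyClosedHom_algebraMap_iff (R K : Type*) [CommRing R] [CommRing K] [Algebra R K]
    [IsFractionRing R K] : IsIntegrallyClosedHom (algebraMap R K) ↔ IsIntegrallyClosed R :=
  (isIntegrallyClosed_iff K).symm

lemma isDomain_of_forall_finset {A : Type*} [CommRing A]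
    (h : ∀ t : Finset A, ∃ S : Subring A, (t : Set A) ⊆ S ∧ IsDomain S) : IsDomain A := by
  classical
  have : Nontrivial A := by
    obtain ⟨S, -, _⟩ := h ∅
    exact S.subtype_injective.nontrivial
  have : NoZeroDivisors A := by
    refine ⟨fun {a b} hab ↦ ?_⟩
    obtain ⟨S, htS, _⟩ := h {a, b}
    lift a to S using htS (by simp)
    lift b to S using htS (by simp)
    exact (mul_eq_zero.mp (Subtype.ext hab : a * b = 0)).imp (congrArg _) (congrArg _)
  exact NoZeroDivisors.to_isDomain A

namespace IsNormalDomain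

variable {A B : Type*} [CommRing A] [CommRing B]

lemma of_ringEquiv (e : A ≃+* B) (h : IsNormalDomain A) : IsNormalDomain B where
  isDomain := have := h.isDomain; e.symm.injective.isDomain e.symm.toRingHom
  isIntegrallyClosed := have := h.isIntegrallyClosed; .of_equiv e

lemma of_isLocalization [Algebra A B] (M : Submonoid A) (hM : M ≤ nonZeroDivisors A)
    [IsLocalization M B] (h : IsNormalDomain A) : IsNormalDomain B where
  isDomain := have := h.isDomain; IsLocalization.isDomain_of_le_nonZeroDivisors B hM
  isIntegrallyClosed :=
    have := h.isDomain
    have := h.isIntegrallyClosed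
    isIntegrallyClosed_of_isLocalization B M hM

lemma of_isIntegrallyClosedHom {f : A →+* B} (hf : IsIntegrallyClosedHom f)
    (hinj : Function.Injective f) (h : IsNormalDomain B) : IsNormalDomain A := by
  have := h.isDomain
  have hA : IsDomain A := hinj.isDomain f
  refine ⟨hA, ?_⟩
  let g : FractionRing A →+* FractionRing B := IsFractionRing.map hinj
  rw [← isIntegrallyClosedHom_algebraMap_iff A (FractionRing A)]
  refine IsIntegrallyClosedHom.of_comp (g := g) ?_ g.injective
  have hg : g.comp (algebraMap A _) = (algebraMap B _).comp f := IsLocalization.map_comp _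
  rw [hg]
  exact ((isIntegrallyClosedHom_algebraMap_iff _ _).mpr h.isIntegrallyClosed).comp hf
    (IsFractionRing.injective B _)

lemma of_forall_finset (h : ∀ t : Finset A, ∃ S : Subring A, (t : Set A) ⊆ S ∧ IsNormalDomain S) :
    IsNormalDomain A := by
  classical
  have hA : IsDomain A := isDomain_of_forall_finset fun t ↦
    (h t).imp fun _ hS ↦ hS.imp_right IsNormalDomain.isDomain
  refine ⟨hA, (isIntegrallyClosedHom_algebraMap_iff A (FractionRing A)).mp ?_⟩
  rintro x ⟨P, hP, hPx⟩
  obtain ⟨a, b, -, rfl⟩ := IsFractionRing.div_surjective (A := A) x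
  obtain ⟨S, htS, hS⟩ := h (insert a (insert b P.coeffs))
  have hcoeffs : (P.coeffs : Set A) ⊆ S := fun c hc ↦ htS (by simp_all)
  lift a to S using htS (by simp)
  lift b to S using htS (by simp)
  have := hS.isDomain
  let g : FractionRing S →+* FractionRing A := IsFractionRing.map S.subtype_injective
  have hg : g.comp (algebraMap S _) = (algebraMap A _).comp S.subtype := IsLocalization.map_comp _
  have hgx : g (algebraMap S _ a / algebraMap S _ b) = algebraMap A _ a / algebraMap A _ b := by
    rw [map_div₀]
    exact congr($hg a / $hg b)
  have hint : (algebraMap S (FractionRing S)).IsIntegralElem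
      (algebraMap S _ a / algebraMap S _ b) := by
    refine .of_map g.injective ⟨P.toSubring S hcoeffs, (P.monic_toSubring S hcoeffs).mpr hP, ?_⟩
    rw [hgx, hg, ← Polynomial.eval₂_map]
    exact (congrArg (Polynomial.eval₂ _ _) (P.map_toSubring S hcoeffs)).trans hPx
  obtain ⟨c, hc⟩ :=
    (isIntegrallyClosedHom_algebraMap_iff S (FractionRing S)).mpr hS.isIntegrallyClosed _ hint
  exact ⟨c, hgx ▸ hc ▸ congr($hg c).symm⟩

end IsNormalDomain

/-! ### Tensor products of normal domains -/

lemma isField_of_isSemisimpleRing {A : Type*} [CommRing A] [Nontrivial A] [IsSemisimpleRing A]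
    (h : ∀ e : A, IsIdempotentElem e → e = 0 ∨ e = 1) : IsField A := by
  refine Ring.isField_iff_isSimpleOrder_ideal.mpr ⟨fun I ↦ ?_⟩
  obtain ⟨e, he, rfl⟩ := IsSemisimpleRing.ideal_eq_span_idempotent I
  exact (h e he).imp (by rintro rfl; simp) (by rintro rfl; simp)

section

variable {K E : Type u} [Field K] [Field E] [Algebra K E]
  [Algebra.IsSeparable K E] [Module.Finite K E]

/-- The idempotents of `E ⊗ L` are integral over `E`, which is integrally closed in `E ⊗ L`. -/
lemma isField_tensorProduct_of_isSeparable {L : Type u} [Field L] [Algebra K L]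
    (hL : IsIntegrallyClosedHom (algebraMap K L)) : IsField (E ⊗[K] L) := by
  have := smooth_of_isSeparable K E
  have hE : IsIntegrallyClosedHom (algebraMap E (E ⊗[K] L)) :=
    (PreservesIntegralClosedness.of_smooth K E).isIntegrallyClosedHom_algebraMap hL
  have : IsSemisimpleRing (E ⊗[K] L) := by
    have : Algebra.FormallyEtale K E := .of_isSeparable K E
    have : IsReduced (L ⊗[K] E) := Algebra.FormallyUnramified.isReduced_of_field L _
    have : IsArtinianRing (L ⊗[K] E) := isArtinian_of_tower L inferInstance
    have : IsSemisimpleRing (L ⊗[K] E) := IsArtinianRing.isSemisimpleRing_of_isReduced _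
    exact (Algebra.TensorProduct.comm K L E).toRingEquiv.isSemisimpleRing
  refine isField_of_isSemisimpleRing fun e he ↦ ?_
  obtain ⟨y, rfl⟩ := hE e ⟨Polynomial.X ^ 2 - Polynomial.X, by monicity!, by simp [sq, he.eq]⟩
  have hy : IsIdempotentElem y := (algebraMap E (E ⊗[K] L)).injective (by simpa using he.eq)
  exact (IsIdempotentElem.iff_eq_zero_or_one.mp hy).imp (by rintro rfl; exact map_zero _)
    (by rintro rfl; exact map_one _)

lemma IsNormalDomain.tensorProduct_of_isSeparable {A : Type u} [CommRing A] [Algebra K A]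
    (hA : IsNormalDomain A) (hKA : IsIntegrallyClosedHom (algebraMap K A)) :
    IsNormalDomain (E ⊗[K] A) := by
  have := hA.isDomain
  have := smooth_of_isSeparable K E
  let L := FractionRing A
  have hL : IsIntegrallyClosedHom (algebraMap A L) :=
    (isIntegrallyClosedHom_algebraMap_iff A L).mpr hA.isIntegrallyClosed
  have hLinj : Function.Injective (algebraMap A L) := IsFractionRing.injective _ _
  have hKL : IsIntegrallyClosedHom (algebraMap K L) :=
    IsScalarTower.algebraMap_eq K A L ▸ hL.comp hKA hLinj
  let := (isField_tensorProduct_of_isSeparable (E := E) hKL).toField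
  exact of_isIntegrallyClosedHom
    (PreservesIntegralClosedness.of_smooth K E A L (IsScalarTower.toAlgHom K A L) hL)
    (Module.Flat.lTensor_preserves_injective_linearMap
      (IsScalarTower.toAlgHom K A L).toLinearMap hLinj)
    ⟨inferInstance, inferInstance⟩

end

section

variable {k K : Type u} [Field k] [Field K] [Algebra k K]

lemma IsNormalDomain.tensorProduct_of_isFractionRing {R A : Type u} [CommRing R] [IsDomain R]
    [Algebra k R] [Algebra R K] [IsScalarTower k R K] [IsFractionRing R K] [CommRing A]
    [Nontrivial A] [Algebra k A] (h : IsNormalDomain (R ⊗[k] A)) : IsNormalDomain (K ⊗[k] A) := by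
  let B := R ⊗[k] A
  have := h.isDomain
  have hinj : Function.Injective (algebraMap R B) :=
    Algebra.TensorProduct.includeLeft_injective (S := k) (algebraMap k A).injective
  have hle : Algebra.algebraMapSubmonoid B (nonZeroDivisors R) ≤ nonZeroDivisors B :=
    map_le_nonZeroDivisors_of_injective _ hinj le_rfl
  exact (h.of_isLocalization (B := B ⊗[R] K) _ hle).of_ringEquiv
    ((Algebra.TensorProduct.comm R B K).toRingEquiv.trans
      (Algebra.TensorProduct.cancelBaseChange k R R K A).toRingEquiv)

variable {F : Type u} [Field F] [Algebra k F]

open scoped IntermediateField.algebraAdjoinAdjoin in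
lemma isNormalDomain_adjoin_tensorProduct {s : Set K}
    (hs : AlgebraicIndependent k ((↑) : s → K)) :
    IsNormalDomain (IntermediateField.adjoin k s ⊗[k] F) := by
  let e : MvPolynomial s k ≃ₐ[k] Algebra.adjoin k s :=
    hs.aevalEquiv.trans (Subalgebra.equivOfEq _ _ (by rw [Subtype.range_coe]))
  have hF : IsNormalDomain (MvPolynomial s F) := ⟨inferInstance, inferInstance⟩
  exact .tensorProduct_of_isFractionRing (R := Algebra.adjoin k s) (hF.of_ringEquiv
    ((MvPolynomial.algebraTensorAlgEquiv k F).symm.toRingEquiv.trans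
      ((Algebra.TensorProduct.comm k F _).trans
        (Algebra.TensorProduct.congr e AlgEquiv.refl)).toRingEquiv))

lemma isNormalDomain_tensorProduct_of_essFiniteType [Algebra.IsGeometricallyReduced k K]
    [Algebra.EssFiniteType k K] (hF : IsIntegrallyClosedHom (algebraMap k F)) :
    IsNormalDomain (K ⊗[k] F) := by
  obtain ⟨s, hs, _, _⟩ := exists_finite_isSeparable_adjoin_of_isGeometricallyReduced k K
  let E := IntermediateField.adjoin k (s : Set K)
  have hE : IsIntegrallyClosedHom (algebraMap E (E ⊗[k] F)) :=
    (PreservesIntegralClosedness.adjoin hs).isIntegrallyClosedHom_algebraMap hF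
  exact ((isNormalDomain_adjoin_tensorProduct hs).tensorProduct_of_isSeparable hE).of_ringEquiv
    (Algebra.TensorProduct.cancelBaseChange k E E K F).toRingEquiv

lemma isNormalDomain_tensorProduct_field [Algebra.IsGeometricallyReduced k K]
    (hF : IsIntegrallyClosedHom (algebraMap k F)) : IsNormalDomain (K ⊗[k] F) := by
  refine .of_forall_finset fun t ↦ ?_
  obtain ⟨E, hE, ht⟩ := exists_fg_forall_mem_range_inclTensor t
  have : Algebra.EssFiniteType k E := IntermediateField.essFiniteType_iff.mpr hE
  have : Algebra.IsGeometricallyReduced k E := .of_injective E.val E.val.injective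
  exact ⟨(inclTensor F E).range.toSubring, ht E le_rfl,
    (isNormalDomain_tensorProduct_of_essFiniteType hF).of_ringEquiv
      (AlgEquiv.ofInjective _ (inclTensor_injective F E)).toRingEquiv⟩

variable (K) in
theorem IsNormalDomain.tensorProduct [Algebra.IsGeometricallyReduced k K] {A : Type u} [CommRing A]
    [Algebra k A] (hA : IsNormalDomain A) (hkA : IsIntegrallyClosedHom (algebraMap k A)) :
    IsNormalDomain (K ⊗[k] A) := by
  have := hA.isDomain
  let F := FractionRing A
  have hF : IsIntegrallyClosedHom (algebraMap A F) :=
    (isIntegrallyClosedHom_algebraMap_iff A F).mpr hA.isIntegrallyClosed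
  have hFinj : Function.Injective (algebraMap A F) := IsFractionRing.injective _ _
  exact of_isIntegrallyClosedHom
    (PreservesIntegralClosedness.of_isGeometricallyReduced k K A F
      (IsScalarTower.toAlgHom k A F) hF)
    (Module.Flat.lTensor_preserves_injective_linearMap
      (IsScalarTower.toAlgHom k A F).toLinearMap hFinj)
    (isNormalDomain_tensorProduct_field
      (IsScalarTower.algebraMap_eq k A F ▸ hF.comp hkA hFinj))

section

variable {A L : Type u} [CommRing A] [Algebra k A] [Field L] [Algebra k L] [Algebra A L]
  [IsScalarTower k A L] [IsFractionRing A L]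

variable (k K A L) in
lemma map_tensorProduct_injective_of_isFractionRing :
    Function.Injective (Algebra.TensorProduct.map (AlgHom.id k K) (IsScalarTower.toAlgHom k A L)) :=
  Module.Flat.lTensor_preserves_injective_linearMap (IsScalarTower.toAlgHom k A L).toLinearMap
    (IsFractionRing.injective A L)

variable (A) in
lemma isDomain_tensorProduct_of_isFractionRing [Algebra.IsGeometricallyReduced k K]
    (hL : IsIntegrallyClosedHom (algebraMap k L)) : IsDomain (K ⊗[k] A) := by
  have := (isNormalDomain_tensorProduct_field (K := K) hL).isDomain
  exact (map_tensorProduct_injective_of_isFractionRing k K A L).isDomain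
    (Algebra.TensorProduct.map (AlgHom.id k K) (IsScalarTower.toAlgHom k A L)).toRingHom

lemma isIntegrallyClosedHom_fractionRing_tensorProduct [Algebra.IsGeometricallyReduced k K]
    (hL : IsIntegrallyClosedHom (algebraMap k L)) {Q : Type u} [Field Q] [Algebra (K ⊗[k] A) Q]
    [IsFractionRing (K ⊗[k] A) Q] :
    IsIntegrallyClosedHom ((algebraMap (K ⊗[k] A) Q).comp (algebraMap K (K ⊗[k] A))) := by
  have hKL := isNormalDomain_tensorProduct_field (K := K) hL
  have := hKL.isDomain
  let Q' := FractionRing (K ⊗[k] L)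
  have hQ' : IsIntegrallyClosedHom ((algebraMap (K ⊗[k] L) Q').comp (algebraMap K _)) :=
    ((isIntegrallyClosedHom_algebraMap_iff _ Q').mpr hKL.isIntegrallyClosed).comp
      ((PreservesIntegralClosedness.of_isGeometricallyReduced k
        K).isIntegrallyClosedHom_algebraMap hL) (IsFractionRing.injective _ _)
  let j : K ⊗[k] A →+* K ⊗[k] L :=
    (Algebra.TensorProduct.map (AlgHom.id k K) (IsScalarTower.toAlgHom k A L)).toRingHom
  have hj : Function.Injective ((algebraMap (K ⊗[k] L) Q').comp j) :=
    (IsFractionRing.injective _ Q').comp (map_tensorProduct_injective_of_isFractionRing k K A L)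
  let g : Q →+* Q' := IsFractionRing.lift hj
  refine .of_comp (g := g) ?_ g.injective
  convert hQ' using 1
  ext c
  simp [g, j, Algebra.TensorProduct.algebraMap_apply]

end

end

/-! ### Integral and normal schemes -/

lemma irreducibleSpace_of_isTopologicalBasis {X Y : Type*} [TopologicalSpace X]
    [TopologicalSpace Y] [IrreducibleSpace X] {B : Set (Set X)}
    (hB : TopologicalSpace.IsTopologicalBasis B) {f : Y → X} (hf : Continuous f)
    (h : ∀ V ∈ B, V.Nonempty → IsIrreducible (f ⁻¹' V)) : IrreducibleSpace Y := by
  have meets {V W : Set X} (hV : V ∈ B) (hW : W ∈ B) (hWV : W ⊆ V) (hne : W.Nonempty) {O : Set Y}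
      (hO : IsOpen O) {y : Y} (hyV : f y ∈ V) (hyO : y ∈ O) : (f ⁻¹' W ∩ O).Nonempty := by
    obtain ⟨w, hw⟩ := (h W hW hne).nonempty
    exact ((h V hV (hne.mono hWV)).isPreirreducible _ O ((hB.isOpen hW).preimage hf) hO
      ⟨w, hWV hw, hw⟩ ⟨y, hyV, hyO⟩).mono Set.inter_subset_right
  have : PreirreducibleSpace Y := by
    refine ⟨fun O₁ O₂ hO₁ hO₂ ⟨y₁, _, hy₁⟩ ⟨y₂, _, hy₂⟩ ↦ ?_⟩
    obtain ⟨V₁, hV₁, hyV₁, -⟩ := hB.exists_subset_of_mem_open (Set.mem_univ (f y₁)) isOpen_univ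
    obtain ⟨V₂, hV₂, hyV₂, -⟩ := hB.exists_subset_of_mem_open (Set.mem_univ (f y₂)) isOpen_univ
    have hVo := (hB.isOpen hV₁).inter (hB.isOpen hV₂)
    obtain ⟨x, hx⟩ := nonempty_preirreducible_inter (hB.isOpen hV₁) (hB.isOpen hV₂)
      ⟨_, hyV₁⟩ ⟨_, hyV₂⟩
    obtain ⟨W, hW, hxW, hWV⟩ := hB.exists_subset_of_mem_open hx hVo
    obtain ⟨hWV₁, hWV₂⟩ := Set.subset_inter_iff.mp hWV
    exact ((h W hW ⟨x, hxW⟩).isPreirreducible O₁ O₂ hO₁ hO₂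
      (meets hV₁ hW hWV₁ ⟨x, hxW⟩ hO₁ hyV₁ hy₁)
      (meets hV₂ hW hWV₂ ⟨x, hxW⟩ hO₂ hyV₂ hy₂)).mono (Set.inter_subset_inter_left _ (by simp))
  obtain ⟨V, hV, hxV, -⟩ := hB.exists_subset_of_mem_open
    (Set.mem_univ (Classical.arbitrary X)) isOpen_univ
  exact ⟨(h V hV ⟨_, hxV⟩).nonempty.to_type⟩

lemma isIntegral_opens_of_isAffineOpen {X : Scheme.{u}} {U : X.Opens} (hU : IsAffineOpen U)
    [IsDomain Γ(X, U)] : IsIntegral U := by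
  have : IsAffine U := hU
  have : IsDomain Γ(U, ⊤) := U.topIso.commRingCatIsoToRingEquiv.toMulEquiv.isDomain _
  have : Nonempty U := by
    by_contra h
    have := not_nonempty_iff.mp h
    exact not_subsingleton Γ(U, ⊤) inferInstance
  exact isIntegral_of_isAffine_of_isDomain _

theorem isIntegral_of_isAffineHom {X Y : Scheme.{u}} (f : Y ⟶ X) [IsAffineHom f] [IsIntegral X]
    (h : ∀ U : X.Opens, IsAffineOpen U → Nonempty U → IsDomain Γ(Y, f ⁻¹ᵁ U)) : IsIntegral Y := by
  have hint {U : X.Opens} (hU : IsAffineOpen U) (hne : Nonempty U) :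
      IsIntegral (f ⁻¹ᵁ U).toScheme :=
    have := h U hU hne
    isIntegral_opens_of_isAffineOpen (hU.preimage f)
  have hred (y : Y) : _root_.IsReduced (Y.presheaf.stalk y) := by
    obtain ⟨U, hU, hyU, -⟩ := exists_isAffineOpen_mem_and_subset (U := ⊤) (x := f y) trivial
    have := hint hU ⟨f y, hyU⟩
    have : _root_.IsReduced ((f ⁻¹ᵁ U).toScheme.presheaf.stalk ⟨y, hyU⟩) :=
      isReduced_stalk_of_isReduced (X := (f ⁻¹ᵁ U).toScheme) _
    exact isReduced_of_injective ((f ⁻¹ᵁ U).stalkIso ⟨y, hyU⟩).inv.hom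
      ((f ⁻¹ᵁ U).stalkIso ⟨y, hyU⟩).symm.commRingCatIsoToRingEquiv.injective
  have : IsReduced Y := isReduced_of_isReduced_stalk Y
  have : IrreducibleSpace Y := by
    refine irreducibleSpace_of_isTopologicalBasis X.isBasis_affineOpens f.continuous ?_
    rintro _ ⟨U, hU, rfl⟩ hne
    have := hint hU hne.to_subtype
    exact isIrreducible_iff_irreducibleSpace.mpr
      (irreducibleSpace_of_isIntegral (X := (f ⁻¹ᵁ U).toScheme))
  exact isIntegral_of_irreducibleSpace_of_isReduced Y

lemma IsNormal.isNormalDomain {X : Scheme.{u}} [IsIntegral X] (h : IsNormal X) {U : X.Opens}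
    (hU : IsAffineOpen U) [Nonempty U] : IsNormalDomain Γ(X, U) := by
  refine ⟨inferInstance, IsIntegrallyClosed.of_localization_maximal fun P _ hP ↦ ?_⟩
  let y : PrimeSpectrum Γ(X, U) := ⟨P, hP.isPrime⟩
  have hy : hU.fromSpec y ∈ U := (hU.isoSpec.inv y).2
  let : Algebra Γ(X, U) (X.presheaf.stalk (hU.fromSpec y)) :=
    X.presheaf.algebra_section_stalk (⟨hU.fromSpec y, hy⟩ : U)
  have : IsLocalization.AtPrime (X.presheaf.stalk (hU.fromSpec y)) P :=
    hU.isLocalization_stalk' y hy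
  have := (h (hU.fromSpec y)).2
  exact .of_equiv (IsLocalization.algEquiv P.primeCompl (X.presheaf.stalk (hU.fromSpec y))
    (Localization.AtPrime P)).toRingEquiv

lemma isNormal_of_forall_exists_isAffineOpen {X : Scheme.{u}}
    (h : ∀ x : X, ∃ U : X.Opens, x ∈ U ∧ IsAffineOpen U ∧ IsNormalDomain Γ(X, U)) :
    IsNormal X := by
  intro x
  obtain ⟨U, hxU, hU, hnormal⟩ := h x
  have := hnormal.isDomain
  let := X.presheaf.algebra_section_stalk (⟨x, hxU⟩ : U)
  have := hU.isLocalization_stalk ⟨x, hxU⟩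
  have := hnormal.of_isLocalization (B := X.presheaf.stalk x) _
    (hU.primeIdealOf ⟨x, hxU⟩).asIdeal.primeCompl_le_nonZeroDivisors
  exact ⟨this.isDomain, this.isIntegrallyClosed⟩

lemma map_genericPoint_of_surjective {X Y : Scheme.{u}} [IsIntegral X] [IsIntegral Y] (f : Y ⟶ X)
    [Surjective f] : f (genericPoint Y) = genericPoint X := by
  have h := (genericPoint_spec Y).image f.continuous
  rw [Set.image_univ, f.surjective.range_eq, closure_univ] at h
  exact h.eq (genericPoint_spec X)

lemma genericPoint_mem_of_nonempty {X : Scheme.{u}} [IsIntegral X] (U : X.Opens) [h : Nonempty U] :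
    genericPoint X ∈ U :=
  ((genericPoint_spec X).mem_open_set_iff U.isOpen).mpr (by simpa using h)

/-! ### Sections and function fields of a scheme over a ring -/

lemma le_preimage_top {X Y : Scheme.{u}} (f : X ⟶ Y) (U : X.Opens) : U ≤ f ⁻¹ᵁ ⊤ := le_top

/-- The homomorphism `R → Γ(X, U)` given by a morphism `X ⟶ Spec R`, the analogue of
`toFunctionField` for sections over an open subscheme. -/
noncomputable def toSections {R : Type u} [CommRing R] {X : Scheme.{u}}
    (α : X ⟶ Spec (CommRingCat.of R)) (U : X.Opens) : R →+* Γ(X, U) :=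
  ((Scheme.ΓSpecIso (CommRingCat.of R)).inv ≫ α.appLE ⊤ U (le_preimage_top _ _)).hom

section

variable {R S : Type u} [CommRing R] [CommRing S] {X Y : Scheme.{u}}
  (α : X ⟶ Spec (CommRingCat.of R)) (β : Y ⟶ Spec (CommRingCat.of S)) (i : R →+* S) (f : Y ⟶ X)

lemma toSections_germ [IsIntegral X] (U : X.Opens) (hU : genericPoint X ∈ U) (r : R) :
    X.presheaf.germ U (genericPoint X) hU (toSections α U r) = toFunctionField α r := by
  have h : α.appLE ⊤ U (le_preimage_top _ _) ≫ X.presheaf.germ U (genericPoint X) hU =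
      α.appTop ≫ X.presheaf.germ ⊤ (genericPoint X) trivial := by
    rw [Scheme.Hom.appLE, Category.assoc, X.presheaf.germ_res]
    rfl
  rw [toFunctionField, ← h]
  rfl

lemma algebraMap_comp_toSections [IsIntegral X] (U : X.Opens) [Nonempty U] :
    (algebraMap Γ(X, U) X.functionField).comp (toSections α U) = toFunctionField α :=
  RingHom.ext (toSections_germ α U (genericPoint_mem_of_nonempty U))

lemma app_toSections (h : f ≫ α = β ≫ specMap i) (U : X.Opens) (r : R) :
    f.app U (toSections α U r) = toSections β (f ⁻¹ᵁ U) (i r) := by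
  have h₁ : (f ≫ α).appLE ⊤ (f ⁻¹ᵁ U) (le_preimage_top _ _) =
      (specMap i).appTop ≫ β.appLE ⊤ (f ⁻¹ᵁ U) (le_preimage_top _ _) := by
    rw [Scheme.Hom.appTop, ← Scheme.Hom.appLE_eq_app]
    exact (by congr 1 : (f ≫ α).appLE ⊤ _ _ = (β ≫ specMap i).appLE ⊤ _ _).trans
      (Scheme.Hom.appLE_comp_appLE _ _ _ _ _ _ _).symm
  have h₂ : (Scheme.ΓSpecIso (CommRingCat.of R)).inv ≫ α.appLE ⊤ U (le_preimage_top _ _) ≫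
      f.app U = CommRingCat.ofHom i ≫ (Scheme.ΓSpecIso (CommRingCat.of S)).inv ≫
        β.appLE ⊤ (f ⁻¹ᵁ U) (le_preimage_top _ _) := by
    rw [Scheme.ΓSpecIso_inv_naturality_assoc, ← Scheme.Hom.appLE_eq_app,
      Scheme.Hom.appLE_comp_appLE, h₁]
  exact congr($(h₂).hom r)

variable [IsIntegral X] [IsIntegral Y] (h : f (genericPoint Y) = genericPoint X)

/-- The extension of function fields given by a dominant morphism of integral schemes. -/
noncomputable def functionFieldMap : X.functionField →+* Y.functionField :=
  (X.presheaf.stalkSpecializes (specializes_of_eq h) ≫ f.stalkMap (genericPoint Y)).hom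

include h in
lemma genericPoint_mem_preimage {U : X.Opens} (hU : genericPoint X ∈ U) :
    genericPoint Y ∈ f ⁻¹ᵁ U := by
  rwa [Scheme.Hom.mem_preimage, h]

lemma functionFieldMap_germ (U : X.Opens) (hU : genericPoint X ∈ U) (s : Γ(X, U)) :
    functionFieldMap f h (X.presheaf.germ U (genericPoint X) hU s) =
      Y.presheaf.germ (f ⁻¹ᵁ U) (genericPoint Y) (genericPoint_mem_preimage f h hU)
        (f.app U s) := by
  have : X.presheaf.germ U (genericPoint X) hU ≫
      X.presheaf.stalkSpecializes (specializes_of_eq h) ≫ f.stalkMap (genericPoint Y) =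
      f.app U ≫ Y.presheaf.germ (f ⁻¹ᵁ U) (genericPoint Y) (genericPoint_mem_preimage f h hU) := by
    rw [TopCat.Presheaf.germ_stalkSpecializes_assoc, Scheme.Hom.germ_stalkMap]
  exact congr($(this).hom s)

lemma functionFieldMap_toFunctionField (w : f ≫ α = β ≫ specMap i) (r : R) :
    functionFieldMap f h (toFunctionField α r) = toFunctionField β (i r) := by
  have hX : genericPoint X ∈ (⊤ : X.Opens) := trivial
  rw [← toSections_germ α ⊤ hX, functionFieldMap_germ, app_toSections α β i f w,
    toSections_germ β]

lemma functionFieldMap_comp {Z : Scheme.{u}} [IsIntegral Z] (g : X ⟶ Z) {e : Y ⟶ Z}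
    (w : f ≫ g = e) (hg : g (genericPoint X) = genericPoint Z)
    (he : e (genericPoint Y) = genericPoint Z) (q : Z.functionField) :
    functionFieldMap f h (functionFieldMap g hg q) = functionFieldMap e he q := by
  subst w
  obtain ⟨U, hU, s, rfl⟩ := Z.presheaf.exists_germ_eq q
  simp only [functionFieldMap_germ, Scheme.Hom.comp_app]
  rfl

lemma isIso_stalkMap_iff_bijective :
    IsIso (f.stalkMap (genericPoint Y)) ↔ Function.Bijective (functionFieldMap f h) := by
  have : IsIso (X.presheaf.stalkSpecializes (specializes_of_eq h)) :=
    (X.presheaf.stalkCongr (.of_eq h)).symm.isIso_hom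
  rw [← isIso_comp_left_iff (X.presheaf.stalkSpecializes (specializes_of_eq h))]
  exact ConcreteCategory.isIso_iff_bijective _

end

/-! ### Base change of schemes -/

section BaseChange

variable {k K : Type u} [CommRing k] [CommRing K] [Algebra k K] {X Y : Scheme.{u}}
  {fst : Y ⟶ X} {snd : Y ⟶ Spec (CommRingCat.of K)} {α : X ⟶ Spec (CommRingCat.of k)}

lemma isAffineHom_fst (sq : IsPullback fst snd α (specMap (algebraMap k K))) : IsAffineHom fst :=
  MorphismProperty.of_isPullback sq.flip inferInstance

lemma isPushout_toSections (sq : IsPullback fst snd α (specMap (algebraMap k K))) {U : X.Opens}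
    (hU : IsAffineOpen U) :
    IsPushout (CommRingCat.ofHom (toSections α U)) (CommRingCat.ofHom (algebraMap k K))
      (fst.app U) (CommRingCat.ofHom (toSections snd (fst ⁻¹ᵁ U))) := by
  have h := (isIso_pushoutSection_iff (US := ⊤) (UT := ⊤) (UX := U) (UY := fst ⁻¹ᵁ U)
    sq (le_preimage_top _ _) (le_preimage_top _ _) (by simp)).mp
    (isIso_pushoutSection_of_isAffineOpen sq (le_preimage_top _ _) (le_preimage_top _ _) (by simp)
      (isAffineOpen_top _) (isAffineOpen_top _) hU)
  refine .of_iso h (Scheme.ΓSpecIso (CommRingCat.of k)) (Iso.refl _)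
    (Scheme.ΓSpecIso (CommRingCat.of K)) (Iso.refl _) ?_ ?_ ?_ ?_
  · simp [toSections]
  · have happ : (specMap (algebraMap k K)).appLE ⊤ ⊤ (le_preimage_top _ _) =
        (specMap (algebraMap k K)).appTop := Scheme.Hom.appLE_eq_app _
    rw [happ]
    exact Scheme.ΓSpecIso_naturality _
  · simp [Scheme.Hom.app_eq_appLE]
  · simp [toSections]

lemma exists_ringEquiv_sections (sq : IsPullback fst snd α (specMap (algebraMap k K)))
    {U : X.Opens} (hU : IsAffineOpen U) [Algebra k Γ(X, U)]
    (halg : algebraMap k Γ(X, U) = toSections α U) :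
    ∃ e : K ⊗[k] Γ(X, U) ≃+* Γ(Y, fst ⁻¹ᵁ U), (∀ c, e (c ⊗ₜ 1) = toSections snd (fst ⁻¹ᵁ U) c) ∧
      ∀ s, e (1 ⊗ₜ s) = fst.app U s := by
  have h₁ := isPushout_toSections sq hU
  rw [← halg] at h₁
  have h₂ := (CommRingCat.isPushout_tensorProduct k K Γ(X, U)).flip
  refine ⟨(h₂.isoIsPushout _ _ h₁).commRingCatIsoToRingEquiv, fun c ↦ ?_, fun s ↦ ?_⟩
  · exact congr($(h₂.inr_isoIsPushout_hom _ _ h₁).hom c)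
  · exact congr($(h₂.inl_isoIsPushout_hom _ _ h₁).hom s)

theorem functionField_eq_top_of_isPullback (sq : IsPullback fst snd α (specMap (algebraMap k K)))
    [IsIntegral X] [IsIntegral Y] (h : fst (genericPoint Y) = genericPoint X)
    {F : Subfield Y.functionField} (hK : ∀ c, toFunctionField snd c ∈ F)
    (hX : ∀ q, functionFieldMap fst h q ∈ F) : F = ⊤ := by
  obtain ⟨U, hU, hx, -⟩ := exists_isAffineOpen_mem_and_subset (U := ⊤) (x := genericPoint X) trivial
  let : Algebra k Γ(X, U) := (toSections α U).toAlgebra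
  obtain ⟨e, he₁, he₂⟩ := exists_ringEquiv_sections sq hU rfl
  have hy : genericPoint Y ∈ fst ⁻¹ᵁ U := genericPoint_mem_preimage fst h hx
  have : Nonempty (fst ⁻¹ᵁ U).toScheme := ⟨⟨_, hy⟩⟩
  have := isAffineHom_fst sq
  have := functionField_isFractionRing_of_isAffineOpen Y _ (hU.preimage fst)
  have hsections (w) : algebraMap Γ(Y, fst ⁻¹ᵁ U) Y.functionField (e w) ∈ F := by
    induction w with
    | zero => simp
    | add a b ha hb => simpa using add_mem ha hb
    | tmul c s =>
      rw [show c ⊗ₜ[k] s = c ⊗ₜ 1 * 1 ⊗ₜ s by simp, map_mul, map_mul, he₁, he₂]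
      refine mul_mem ?_ ?_
      · rw [← RingHom.comp_apply, algebraMap_comp_toSections]
        exact hK c
      · exact functionFieldMap_germ fst h U hx s ▸ hX _
  refine eq_top_iff.mpr fun q _ ↦ ?_
  obtain ⟨a, b, -, rfl⟩ := IsFractionRing.div_surjective (A := Γ(Y, fst ⁻¹ᵁ U)) q
  obtain ⟨a, rfl⟩ := e.surjective a
  obtain ⟨b, rfl⟩ := e.surjective b
  exact div_mem (hsections a) (hsections b)

theorem isIntegral_of_isDomain_tensorProduct
    (sq : IsPullback fst snd α (specMap (algebraMap k K))) [IsIntegral X]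
    (h : ∀ (U : X.Opens) [Nonempty U] [Algebra k Γ(X, U)], IsAffineOpen U →
      algebraMap k Γ(X, U) = toSections α U → IsDomain (K ⊗[k] Γ(X, U))) : IsIntegral Y := by
  have := isAffineHom_fst sq
  refine isIntegral_of_isAffineHom fst fun U hU hne ↦ ?_
  let : Algebra k Γ(X, U) := (toSections α U).toAlgebra
  obtain ⟨e, -⟩ := exists_ringEquiv_sections sq hU rfl
  have := h U hU rfl
  exact e.symm.toMulEquiv.isDomain _

end BaseChange

/-! ### Base change of a scheme over a field -/

lemma exists_field_toCommRing_eq {R : Type*} [inst : CommRing R] (hR : IsField R) :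
    ∃ F : Field R, F.toCommRing = inst :=
  ⟨hR.toField, rfl⟩

section BaseChangeField

variable {k K : Type u} [Field k] [CommRing K] [Algebra k K] {X Y : Scheme.{u}}
  {fst : Y ⟶ X} {snd : Y ⟶ Spec (CommRingCat.of K)} {α : X ⟶ Spec (CommRingCat.of k)}

lemma surjective_fst [Nontrivial K] (sq : IsPullback fst snd α (specMap (algebraMap k K))) :
    Surjective fst :=
  MorphismProperty.of_isPullback sq.flip
    ((flat_and_surjective_SpecMap_iff (CommRingCat.ofHom (algebraMap k K))).mpr
      (RingHom.faithfullyFlat_algebraMap_iff.mpr inferInstance)).2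

variable [Algebra.IsGeometricallyReduced k K] [IsIntegral X]

theorem isIntegral_of_isPullback (hK : IsField K)
    (sq : IsPullback fst snd α (specMap (algebraMap k K)))
    (hα : IsIntegrallyClosedHom (toFunctionField α)) : IsIntegral Y := by
  obtain ⟨_, rfl⟩ := exists_field_toCommRing_eq hK
  refine isIntegral_of_isDomain_tensorProduct sq fun U _ _ hU halg ↦ ?_
  let : Algebra k X.functionField := (toFunctionField α).toAlgebra
  have : IsScalarTower k Γ(X, U) X.functionField :=
    .of_algebraMap_eq' (halg ▸ (algebraMap_comp_toSections α U).symm)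
  have := functionField_isFractionRing_of_isAffineOpen X U hU
  exact isDomain_tensorProduct_of_isFractionRing Γ(X, U) hα

theorem isNormal_of_isPullback (hK : IsField K)
    (sq : IsPullback fst snd α (specMap (algebraMap k K)))
    (hα : IsIntegrallyClosedHom (toFunctionField α)) (hX : IsNormal X) : IsNormal Y := by
  obtain ⟨_, rfl⟩ := exists_field_toCommRing_eq hK
  have := isAffineHom_fst sq
  refine isNormal_of_forall_exists_isAffineOpen fun y ↦ ?_
  obtain ⟨U, hU, hyU, -⟩ := exists_isAffineOpen_mem_and_subset (U := ⊤) (x := fst y) trivial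
  have : Nonempty U := ⟨_, hyU⟩
  let : Algebra k Γ(X, U) := (toSections α U).toAlgebra
  obtain ⟨e, -⟩ := exists_ringEquiv_sections sq hU rfl
  have hkU : IsIntegrallyClosedHom (algebraMap k Γ(X, U)) :=
    .of_comp (algebraMap_comp_toSections α U ▸ hα) (X.germToFunctionField_injective U)
  exact ⟨fst ⁻¹ᵁ U, hyU, hU.preimage fst,
    ((hX.isNormalDomain hU).tensorProduct K hkU).of_ringEquiv e⟩

theorem isIntegrallyClosedHom_toFunctionField [IsIntegral Y] (hK : IsField K)
    (sq : IsPullback fst snd α (specMap (algebraMap k K)))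
    (hα : IsIntegrallyClosedHom (toFunctionField α)) :
    IsIntegrallyClosedHom (toFunctionField snd) := by
  obtain ⟨_, rfl⟩ := exists_field_toCommRing_eq hK
  have := isAffineHom_fst sq
  have := surjective_fst sq
  obtain ⟨U, hU, hx, -⟩ := exists_isAffineOpen_mem_and_subset (U := ⊤) (x := genericPoint X) trivial
  have : Nonempty U := ⟨_, hx⟩
  have : Nonempty (fst ⁻¹ᵁ U).toScheme :=
    ⟨⟨_, genericPoint_mem_preimage fst (map_genericPoint_of_surjective fst) hx⟩⟩
  let : Algebra k Γ(X, U) := (toSections α U).toAlgebra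
  let : Algebra k X.functionField := (toFunctionField α).toAlgebra
  have : IsScalarTower k Γ(X, U) X.functionField :=
    .of_algebraMap_eq' (algebraMap_comp_toSections α U).symm
  have := functionField_isFractionRing_of_isAffineOpen X U hU
  obtain ⟨e, he, -⟩ := exists_ringEquiv_sections sq hU rfl
  let : Algebra (K ⊗[k] Γ(X, U)) Y.functionField :=
    ((algebraMap Γ(Y, fst ⁻¹ᵁ U) Y.functionField).comp e.toRingHom).toAlgebra
  have := functionField_isFractionRing_of_isAffineOpen Y _ (hU.preimage fst)
  have : IsFractionRing (K ⊗[k] Γ(X, U)) Y.functionField :=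
    IsFractionRing.of_ringEquiv_left e fun _ ↦ rfl
  have heq : toFunctionField snd = (algebraMap (K ⊗[k] Γ(X, U)) Y.functionField).comp
      (algebraMap K (K ⊗[k] Γ(X, U))) := by
    rw [← algebraMap_comp_toSections snd (fst ⁻¹ᵁ U)]
    exact RingHom.ext fun c ↦ congrArg _ (he c).symm
  exact heq ▸ isIntegrallyClosedHom_fractionRing_tensorProduct (L := X.functionField) hα

end BaseChangeField

lemma pow_mem_range_functionFieldMap {k K : Type u} [CommRing k] [CommRing K] [Algebra k K]
    {X Y : Scheme.{u}} {fst : Y ⟶ X} {snd : Y ⟶ Spec (CommRingCat.of K)}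
    {α : X ⟶ Spec (CommRingCat.of k)} (sq : IsPullback fst snd α (specMap (algebraMap k K)))
    [IsIntegral X] [IsIntegral Y] (h : fst (genericPoint Y) = genericPoint X) (p : ℕ)
    [ExpChar X.functionField p] (hp : ∀ x : K, x ^ p ∈ (algebraMap k K).range)
    (q : Y.functionField) : q ^ p ∈ (functionFieldMap fst h).range := by
  have : ExpChar Y.functionField p :=
    expChar_of_injective_ringHom (functionFieldMap fst h).injective p
  let F := (functionFieldMap fst h).fieldRange.comap (frobenius Y.functionField p)
  have hF : F = ⊤ := by
    refine functionField_eq_top_of_isPullback sq h (fun c ↦ ?_) fun q ↦ ⟨q ^ p, map_pow _ _ _⟩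
    obtain ⟨r, hr⟩ := hp c
    refine ⟨toFunctionField α r, ?_⟩
    rw [functionFieldMap_toFunctionField α snd _ fst h sq.w, hr, map_pow]
    rfl
  exact (hF ▸ Subfield.mem_top q : q ∈ F)

/-! ### Base change of a normalisation -/

namespace IsNormalization

lemma surjective {Y Z : Scheme.{u}} {ν : Y ⟶ Z} (h : IsNormalization ν) : Surjective ν := by
  have := h.isIntegral_source
  have := h.isIntegral_target
  have := h.isIntegralHom
  have hclosure : closure {genericPoint Z} ⊆ Set.range ν :=
    ν.isClosedMap.isClosed_range.closure_subset_iff.mpr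
      (Set.singleton_subset_iff.mpr ⟨_, h.map_genericPoint⟩)
  exact ⟨Set.range_eq_univ.mp (Set.eq_univ_of_univ_subset (genericPoint_spec Z ▸ hclosure))⟩

lemma injective_app {X Z : Scheme.{u}} {ν : X ⟶ Z} (hν : IsNormalization ν) (U : Z.Opens)
    [Nonempty U] : Function.Injective (ν.app U) := by
  have := hν.isIntegral_source
  have := hν.isIntegral_target
  have hU := genericPoint_mem_of_nonempty U
  refine .of_comp (f := X.presheaf.germ (ν ⁻¹ᵁ U) (genericPoint X)
    (genericPoint_mem_preimage ν hν.map_genericPoint hU)) ?_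
  have h := (functionFieldMap ν hν.map_genericPoint).injective.comp
    (germ_injective_of_isIntegral Z (genericPoint Z) hU)
  exact fun s t hst ↦ h (by simpa [functionFieldMap_germ] using hst)

variable {k K : Type u} [Field k] [CommRing K] [Nontrivial K] [Algebra k K]
  {X Z Y Z₁ : Scheme.{u}} {ν : X ⟶ Z} {β : Z ⟶ Spec (CommRingCat.of k)} {g : Z₁ ⟶ Z}
  {z : Z₁ ⟶ Spec (CommRingCat.of K)} {f : Y ⟶ X}

lemma isIntegral_of_isPullback (hν : IsNormalization ν)
    (sqZ : IsPullback g z β (specMap (algebraMap k K))) {y : Y ⟶ Spec (CommRingCat.of K)}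
    (sqX : IsPullback f y (ν ≫ β) (specMap (algebraMap k K))) [IsIntegral Y] : IsIntegral Z₁ := by
  have := hν.isIntegral_source
  have := hν.isIntegral_target
  have := hν.isIntegralHom
  have := surjective_fst sqX
  have hf := map_genericPoint_of_surjective f
  refine isIntegral_of_isDomain_tensorProduct sqZ fun U _ _ hU halg ↦ ?_
  let : Algebra k Γ(X, ν ⁻¹ᵁ U) := (toSections (ν ≫ β) (ν ⁻¹ᵁ U)).toAlgebra
  let j : Γ(Z, U) →ₐ[k] Γ(X, ν ⁻¹ᵁ U) := ⟨(ν.app U).hom, fun r ↦ by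
    rw [halg]
    exact app_toSections β (ν ≫ β) (RingHom.id k) ν (by simp [specMap]) U r⟩
  obtain ⟨e, -⟩ := exists_ringEquiv_sections sqX (hU.preimage ν) rfl
  have : Nonempty (f ⁻¹ᵁ ν ⁻¹ᵁ U).toScheme := ⟨⟨_, genericPoint_mem_preimage f hf
    (genericPoint_mem_preimage ν hν.map_genericPoint (genericPoint_mem_of_nonempty U))⟩⟩
  have := e.toMulEquiv.isDomain _
  exact (Module.Flat.lTensor_preserves_injective_linearMap (M := K) j.toLinearMap
    (hν.injective_app U)).isDomain (Algebra.TensorProduct.map (AlgHom.id k K) j).toRingHom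

theorem of_isPullback {ν₁ : Y ⟶ Z₁} (hν : IsNormalization ν) (w : ν₁ ≫ g = f ≫ ν)
    (sqZ : IsPullback g z β (specMap (algebraMap k K)))
    (sqX : IsPullback f (ν₁ ≫ z) (ν ≫ β) (specMap (algebraMap k K))) [IsIntegral Y]
    (hY : IsNormal Y) : IsNormalization ν₁ := by
  have := hν.isIntegral_source
  have := hν.isIntegral_target
  have sq : IsPullback f ν₁ ν g := .of_bot sqX w.symm sqZ
  have := surjective_fst sqX
  have := surjective_fst sqZ
  have hf := map_genericPoint_of_surjective f
  have hZ₁ : IsIntegral Z₁ := hν.isIntegral_of_isPullback sqZ sqX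
  have hg := map_genericPoint_of_surjective g
  have : IsIntegralHom ν₁ := MorphismProperty.of_isPullback sq hν.isIntegralHom
  have : Surjective ν₁ := MorphismProperty.of_isPullback sq hν.surjective
  have hν₁ := map_genericPoint_of_surjective ν₁
  have hrange : (functionFieldMap ν₁ hν₁).fieldRange = ⊤ := by
    refine functionField_eq_top_of_isPullback sqX hf (fun c ↦ ⟨toFunctionField z c, ?_⟩) fun x ↦ ?_
    · exact functionFieldMap_toFunctionField z _ (RingHom.id K) ν₁ hν₁ (by simp [specMap]) c
    · have hbij := (isIso_stalkMap_iff_bijective ν hν.map_genericPoint).mp hν.isIso_stalkMap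
      obtain ⟨x, rfl⟩ := hbij.2 x
      have he : (f ≫ ν) (genericPoint Y) = genericPoint Z := by simp [hf, hν.map_genericPoint]
      refine ⟨functionFieldMap g hg x, ?_⟩
      rw [functionFieldMap_comp f hf ν rfl _ he, functionFieldMap_comp ν₁ hν₁ g w _ he]
  exact ⟨hY, inferInstance, hν₁, (isIso_stalkMap_iff_bijective ν₁ hν₁).mpr
    ⟨RingHom.injective _, RingHom.fieldRange_eq_top_iff.mp hrange⟩⟩

end IsNormalization

/-! ### Purely inseparable extensions and base change -/

lemma isPurelyInseparableHom_of_pow_mem {R S : Type u} [CommRing R] [CommRing S]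
    (hR : IsField R) (hS : IsField S) (p : ℕ) [ExpChar R p] {i : R →+* S}
    (h : ∀ x : S, x ^ p ∈ i.range) : IsPurelyInseparableHom i := by
  obtain ⟨_, rfl⟩ := exists_field_toCommRing_eq hR
  obtain ⟨_, rfl⟩ := exists_field_toCommRing_eq hS
  let := i.toAlgebra
  exact (isPurelyInseparable_iff_pow_mem R p).mpr fun x ↦ ⟨1, by rw [pow_one]; exact h x⟩

section

variable {k l k' K : Type u} [Field k] [CommRing l] [CommRing k'] [Field K] [Algebra k l]
  [Algebra k k'] [Algebra l k'] [IsScalarTower k l k'] [Algebra k K]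

variable (l k' K) in
lemma tensorMap_comp_inclRight :
    (tensorMap (k := k) K l k').comp (inclRight (k := k) K l) = inclRight (k := k) K k' := by
  ext x
  simp

variable (l k' K) in
lemma tensorMap_comp_algebraMap :
    (tensorMap (k := k) K l k').comp (algebraMap l (l ⊗[k] K)) =
      (algebraMap k' (k' ⊗[k] K)).comp (algebraMap l k') := by
  ext x
  simp

variable (p : ℕ) [ExpChar k p]

lemma pow_mem_range_inclRight (h : ∀ x : l, x ^ p ∈ (algebraMap k l).range) (x : l ⊗[k] K) :
    x ^ p ∈ (inclRight (k := k) K l).range := by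
  obtain _ | _ := subsingleton_or_nontrivial (l ⊗[k] K)
  · exact ⟨0, Subsingleton.elim _ _⟩
  have : ExpChar (l ⊗[k] K) p := expChar_of_injective_algebraMap (algebraMap k _).injective p
  induction x with
  | zero => simp [(expChar_pos k p).ne']
  | add a b ha hb => exact add_pow_expChar a b p ▸ add_mem ha hb
  | tmul a b =>
    obtain ⟨c, hc⟩ := h a
    refine ⟨c • b ^ p, ?_⟩
    rw [Algebra.TensorProduct.tmul_pow, ← hc, Algebra.algebraMap_eq_smul_one,
      TensorProduct.smul_tmul]
    rfl

lemma pow_mem_range_tensorMap (h : ∀ x : k', x ^ p ∈ (algebraMap k k').range) (x : k' ⊗[k] K) :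
    x ^ p ∈ (tensorMap (k := k) K l k').range := by
  obtain ⟨c, hc⟩ := pow_mem_range_inclRight p h x
  exact ⟨inclRight (k := k) K l c, congr($(tensorMap_comp_inclRight l k' K) c).trans hc⟩

lemma isField_tensorProduct_of_pow_mem [Nontrivial l] [IsReduced (l ⊗[k] K)]
    (h : ∀ x : l, x ^ p ∈ (algebraMap k l).range) : IsField (l ⊗[k] K) := by
  refine ⟨⟨0, 1, zero_ne_one⟩, mul_comm, fun {x} hx ↦ ?_⟩
  obtain ⟨c, hc⟩ := pow_mem_range_inclRight p h x
  have hc0 : c ≠ 0 := by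
    rintro rfl
    exact pow_ne_zero p hx (by rw [← hc, map_zero])
  refine ⟨x ^ (p - 1) * inclRight (k := k) K l c⁻¹, ?_⟩
  rw [← mul_assoc, ← pow_succ', Nat.sub_add_cancel (expChar_pos k p), ← hc, ← map_mul,
    mul_inv_cancel₀ hc0, map_one]

end

/-! ### Degrees -/

lemma degree_eq_rank_of_ringEquiv {R S A B : Type u} [CommRing R] [CommRing S] [CommRing A]
    [CommRing B] [Algebra R S] [Algebra R A] [Nontrivial R] [Nontrivial S] [Module.Free R A]
    (i : S →+* B) (e : S ⊗[R] A ≃+* B) (h : ∀ s, e (s ⊗ₜ 1) = i s) :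
    degree i = Module.rank R A := by
  let := i.toAlgebra
  have e' : S ⊗[R] A ≃ₐ[S] B := AlgEquiv.ofRingEquiv (f := e) h
  exact e'.toLinearEquiv.rank_eq.symm.trans (by rw [Module.rank_baseChange, Cardinal.lift_id])

section

variable {k : Type u} [Field k] (l k' K : Type u) [Field K] [Algebra k K]

lemma degree_inclRight [CommRing l] [Algebra k l] :
    degree (inclRight (k := k) K l) = Module.rank k l :=
  degree_eq_rank_of_ringEquiv _ (Algebra.TensorProduct.comm k K l).toRingEquiv fun _ ↦ rfl

lemma degree_tensorMap [Field l] [CommRing k'] [Algebra k l] [Algebra k k'] [Algebra l k']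
    [IsScalarTower k l k'] : degree (tensorMap (k := k) K l k') = Module.rank l k' := by
  refine degree_eq_rank_of_ringEquiv _
    ((Algebra.TensorProduct.comm l (l ⊗[k] K) k').toRingEquiv.trans
      (Algebra.TensorProduct.cancelBaseChange k l l k' K).toRingEquiv) fun s ↦ ?_
  induction s with
  | zero => simp
  | add a b ha hb => simp only [TensorProduct.add_tmul, map_add, ha, hb]
  | tmul a b => simp [Algebra.algebraMap_eq_smul_one]

end

/-! ### Constant fields of elemental extensions -/

lemma isAlgebraicElem_iff_isIntegralElem {R S : Type u} [CommRing R] [CommRing S]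
    (hR : IsField R) (i : R →+* S) (x : S) : IsAlgebraicElem i x ↔ i.IsIntegralElem x := by
  obtain ⟨_, rfl⟩ := exists_field_toCommRing_eq hR
  let := i.toAlgebra
  exact isAlgebraic_iff_isIntegral

lemma IsAlgClosedInFunctionField.isIntegrallyClosedHom {k : Type u} [Field k] {X : Scheme.{u}}
    [IsIntegral X] {α : X ⟶ Spec (CommRingCat.of k)} (h : IsAlgClosedInFunctionField α) :
    IsIntegrallyClosedHom (toFunctionField α) :=
  fun x hx ↦ h.mem_range x ((isAlgebraicElem_iff_isIntegralElem (Field.toIsField k) _ _).mpr hx)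

lemma isIntegral_of_forall_pow_mem_range {R S : Type*} [CommRing R] [CommRing S] {i : R →+* S}
    {n : ℕ} (hn : n ≠ 0) (h : ∀ x, x ^ n ∈ i.range) : i.IsIntegral := by
  intro x
  obtain ⟨c, hc⟩ := h x
  exact ⟨Polynomial.X ^ n - Polynomial.C c, Polynomial.monic_X_pow_sub_C c hn, by simp [hc]⟩

lemma isIntegralElem_comp_iff {R S T : Type*} [CommRing R] [CommRing S] [CommRing T] {j : R →+* S}
    (hj : j.IsIntegral) (g : S →+* T) (x : T) :
    (g.comp j).IsIntegralElem x ↔ g.IsIntegralElem x := by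
  refine ⟨fun hx ↦ hx.of_comp, fun hx ↦ ?_⟩
  algebraize [j, g, g.comp j]
  exact isIntegral_trans (R := R) (A := S) x hx

namespace IsElementalExtension

variable {p : ℕ} {k l k' : Type u} [Field k] [Field l] [Field k'] {i : k →+* l} {j : l →+* k'}
  {X X' : Scheme.{u}} {α : X ⟶ Spec (CommRingCat.of k)} {α' : X' ⟶ Spec (CommRingCat.of k')}
  {φ : X' ⟶ X}

lemma isIntegral (hφ : IsElementalExtension p i j α α' φ) : j.IsIntegral := by
  intro y
  have := hφ.isNormalization.isIntegral_source
  have hy : ((toFunctionField α').comp j).IsIntegralElem (toFunctionField α' y) :=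
    (isAlgebraicElem_iff_isIntegralElem hφ.isField_left _ _).mp
      ((hφ.isAlgebraicElem_iff _).mpr ⟨y, rfl⟩)
  exact hy.of_map (toFunctionField α').injective

lemma isIntegrallyClosedHom_toFunctionField [IsIntegral X']
    (hφ : IsElementalExtension p i j α α' φ) : IsIntegrallyClosedHom (toFunctionField α') :=
  fun x hx ↦ (hφ.isAlgebraicElem_iff x).mp ((isAlgebraicElem_iff_isIntegralElem hφ.isField_left
    _ _).mpr ((isIntegralElem_comp_iff hφ.isIntegral _ x).mpr hx))

variable [IsIntegral X]

lemma exists_functionFieldMap_eq_pow [ExpChar k p] [IsIntegral X']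
    (hφ : IsElementalExtension p i j α α' φ) :
    ∃ h : φ (genericPoint X') = genericPoint X,
      ∀ q : X'.functionField, ∃ w, functionFieldMap φ h w = q ^ p := by
  obtain ⟨ν, hν, hcomp⟩ : ∃ ν : X' ⟶ pullback α (specMap i),
      IsNormalization ν ∧ ν ≫ pullback.fst _ _ = φ :=
    ⟨_, hφ.isNormalization, pullback.lift_fst _ _ _⟩
  have := hν.isIntegral_target
  let := i.toAlgebra
  have sq : IsPullback _ _ α (specMap (algebraMap k l)) := .of_hasPullback α (specMap i)
  have := surjective_fst sq
  have hfst := map_genericPoint_of_surjective (pullback.fst α (specMap i))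
  have hφη : φ (genericPoint X') = genericPoint X := by
    rw [← hcomp, Scheme.Hom.comp_apply, hν.map_genericPoint, hfst]
  refine ⟨hφη, fun q ↦ ?_⟩
  obtain ⟨z, rfl⟩ := ((isIso_stalkMap_iff_bijective ν hν.map_genericPoint).mp hν.isIso_stalkMap).2 q
  have : ExpChar X.functionField p := expChar_of_injective_ringHom (toFunctionField α).injective p
  obtain ⟨w, hw⟩ := pow_mem_range_functionFieldMap sq hfst p hφ.pow_mem_range z
  exact ⟨w, by rw [← functionFieldMap_comp ν hν.map_genericPoint _ hcomp hfst, hw, map_pow]⟩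

lemma pow_mem_range_comp [ExpChar k p] (hφ : IsElementalExtension p i j α α' φ)
    (hα : IsIntegrallyClosedHom (toFunctionField α)) (x : k') : x ^ p ∈ (j.comp i).range := by
  have := hφ.isNormalization.isIntegral_source
  obtain ⟨hφη, hpow⟩ := hφ.exists_functionFieldMap_eq_pow
  obtain ⟨w, hw⟩ := hpow (toFunctionField α' x)
  have hcomm : (functionFieldMap φ hφη).comp (toFunctionField α) =
      (toFunctionField α').comp (j.comp i) :=
    RingHom.ext (functionFieldMap_toFunctionField α α' _ φ hφη hφ.comm)
  have hx : (j.comp i).IsIntegralElem (x ^ p) :=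
    (isIntegral_of_forall_pow_mem_range (expChar_ne_zero k p) hφ.pow_mem_range).trans _ _
      hφ.isIntegral _
  have hwk : (toFunctionField α).IsIntegralElem w := by
    refine .of_map (functionFieldMap φ hφη).injective ?_
    rw [hcomm, hw, ← map_pow]
    exact hx.map _
  obtain ⟨c, rfl⟩ := hα w hwk
  refine ⟨c, (toFunctionField α').injective ?_⟩
  rw [map_pow, ← hw]
  exact congr($hcomm c).symm

end IsElementalExtension

/-! ### Cartesian squares over `k → k₁` -/

section Squares

variable {k : Type u} [Field k] (K : Type u)

lemma isPullback_specMap_tensorProduct [CommRing K] [Algebra k K] (A : Type u) [CommRing A]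
    [Algebra k A] :
    IsPullback (specMap (algebraMap A (A ⊗[k] K)))
      (specMap (Algebra.TensorProduct.includeRight : K →ₐ[k] A ⊗[k] K).toRingHom)
      (specMap (algebraMap k A)) (specMap (algebraMap k K)) :=
  isPullback_SpecMap_of_isPushout _ _ _ _ (CommRingCat.isPushout_tensorProduct k A K)

variable [Field K] [Algebra k K] {X : Scheme.{u}}

lemma baseChangeMap_comp_baseChangeStr {X' : Scheme.{u}} (α : X ⟶ Spec (CommRingCat.of k))
    (φ : X' ⟶ X) : baseChangeMap K α φ ≫ baseChangeStr K α = baseChangeStr K (φ ≫ α) :=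
  (pullback.lift_snd _ _ _).trans (Category.comp_id _)

section baseChangeTop

variable {k' : Type u} [Field k'] [Algebra k k'] {α' : X ⟶ Spec (CommRingCat.of k')}
  {β : X ⟶ Spec (CommRingCat.of k)} (h : β = α' ≫ specMap (algebraMap k k'))

lemma baseChangeTop_comp_inclRight :
    baseChangeTop K β α' h ≫ specMap (inclRight (k := k) K k') = baseChangeStr K β := by
  have hsnd : (pullbackSpecIso k k' K).hom ≫ specMap (inclRight (k := k) K k') =
      pullback.snd _ _ := pullbackSpecIso_hom_snd k k' K
  rw [Category.assoc, hsnd]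
  exact (pullback.lift_snd _ _ _).trans (Category.comp_id _)

lemma baseChangeTop_comp_algebraMap :
    baseChangeTop K β α' h ≫ specMap (algebraMap k' (k' ⊗[k] K)) = pullback.fst _ _ ≫ α' := by
  have hfst : (pullbackSpecIso k k' K).hom ≫ specMap (algebraMap k' (k' ⊗[k] K)) =
      pullback.fst _ _ := pullbackSpecIso_hom_fst' k k' K
  rw [Category.assoc, hfst]
  exact pullback.lift_fst _ _ _

lemma isPullback_baseChangeTop :
    IsPullback (pullback.fst β (specMap (algebraMap k K))) (baseChangeTop K β α' h) α'
      (specMap (algebraMap k' (k' ⊗[k] K))) := by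
  refine .of_bot ?_ (baseChangeTop_comp_algebraMap K h).symm (isPullback_specMap_tensorProduct K k')
  rw [baseChangeTop_comp_inclRight, ← h]
  exact IsPullback.of_hasPullback _ _

end baseChangeTop

lemma exists_isPullback_baseChangeStr (l : Type u) [CommRing l] [Algebra k l]
    (α : X ⟶ Spec (CommRingCat.of k)) :
    ∃ g : pullback (baseChangeStr K α) (specMap (inclRight (k := k) K l)) ⟶
        pullback α (specMap (algebraMap k l)),
      g ≫ pullback.fst _ _ = pullback.fst _ _ ≫ pullback.fst _ _ ∧
      g ≫ pullback.snd _ _ = pullback.snd _ _ ≫ specMap (algebraMap l (l ⊗[k] K)) ∧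
      IsPullback g (pullback.fst _ _ ≫ baseChangeStr K α) (pullback.fst _ _ ≫ α)
        (specMap (algebraMap k K)) := by
  have hs := (IsPullback.of_hasPullback (baseChangeStr K α)
    (specMap (inclRight (k := k) K l))).flip.paste_horiz (isPullback_specMap_tensorProduct K l)
  rw [← pullback.condition (f := α) (g := specMap (algebraMap k K))] at hs
  have ht := (IsPullback.of_hasPullback α (specMap (algebraMap k l))).flip
  have hw := hs.w.trans (Category.assoc _ _ _).symm
  have hg := ht.lift_snd _ _ hw
  refine ⟨ht.lift _ _ hw, hg, ht.lift_fst _ _ _, ?_⟩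
  refine .paste_vert (.of_right ?_ hg ht) (IsPullback.of_hasPullback α (specMap (algebraMap k K)))
  rwa [ht.lift_fst]

end Squares

/-! ### Separable base change -/

section SeparableBaseChange

variable {k k₁ : Type u} [Field k] [Field k₁] [Algebra k k₁]

section Schemes

variable {X : Scheme.{u}} {α : X ⟶ Spec (CommRingCat.of k)}

theorem IsAlgClosedInFunctionField.baseChange (hk : IsAlgClosedInFunctionField α)
    (hk₁ : IsSeparableExtension k k₁) : IsAlgClosedInFunctionField (baseChangeStr k₁ α) := by
  have := hk.isIntegral
  have := hk₁.isGeometricallyReduced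
  have sq := IsPullback.of_hasPullback α (specMap (algebraMap k k₁))
  have hk₁F := Field.toIsField k₁
  have := isIntegral_of_isPullback hk₁F sq hk.isIntegrallyClosedHom
  exact ⟨fun x hx ↦ isIntegrallyClosedHom_toFunctionField hk₁F sq hk.isIntegrallyClosedHom x
    ((isAlgebraicElem_iff_isIntegralElem hk₁F _ x).mp hx)⟩

theorem IsVariety.baseChange (hX : IsVariety α) (hk : IsAlgClosedInFunctionField α)
    (hk₁ : IsSeparableExtension k k₁) : IsVariety (baseChangeStr k₁ α) := by
  have := hX.isSeparated
  have := hX.locallyOfFiniteType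
  have := hX.quasiCompact
  exact ⟨(hk.baseChange hk₁).isIntegral, inferInstance, inferInstance, inferInstance⟩

theorem IsNormal.baseChange (hX : IsNormal X) (hk : IsAlgClosedInFunctionField α)
    (hk₁ : IsSeparableExtension k k₁) : IsNormal (baseChange k₁ α) := by
  have := hk.isIntegral
  have := hk₁.isGeometricallyReduced
  exact isNormal_of_isPullback (Field.toIsField k₁)
    (.of_hasPullback α (specMap (algebraMap k k₁))) hk.isIntegrallyClosedHom hX

end Schemes

section Fields

variable {l k' : Type u} [Field l] [Field k'] [Algebra k l] [Algebra l k'] [Algebra k k']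
  [IsScalarTower k l k'] (p : ℕ) [ExpChar k p] (hk₁ : IsSeparableExtension k k₁)

include hk₁

lemma IsSeparableExtension.isField_tensorProduct
    (hl : ∀ x : l, x ^ p ∈ (algebraMap k l).range) : IsField (l ⊗[k] k₁) := by
  have := hk₁ l
  exact isField_tensorProduct_of_pow_mem p hl

lemma IsSeparableExtension.isPurelyInseparableHom_inclRight
    (hl : ∀ x : l, x ^ p ∈ (algebraMap k l).range) :
    IsPurelyInseparableHom (inclRight (k := k) k₁ l) := by
  have : ExpChar k₁ p := expChar_of_injective_algebraMap (algebraMap k k₁).injective p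
  exact isPurelyInseparableHom_of_pow_mem (Field.toIsField k₁) (hk₁.isField_tensorProduct p hl) p
    (pow_mem_range_inclRight p hl)

lemma IsSeparableExtension.isPurelyInseparableHom_tensorMap
    (hl : ∀ x : l, x ^ p ∈ (algebraMap k l).range)
    (hk' : ∀ x : k', x ^ p ∈ (algebraMap k k').range) :
    IsPurelyInseparableHom (tensorMap (k := k) k₁ l k') := by
  have : ExpChar (l ⊗[k] k₁) p :=
    expChar_of_injective_algebraMap (algebraMap k (l ⊗[k] k₁)).injective p
  exact isPurelyInseparableHom_of_pow_mem (hk₁.isField_tensorProduct p hl)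
    (hk₁.isField_tensorProduct p hk') p (pow_mem_range_tensorMap p hk')

end Fields

namespace IsElementalExtension

variable {p : ℕ} {l k' : Type u} [Field l] [Field k'] [Algebra k l] [Algebra l k'] [Algebra k k']
  [IsScalarTower k l k'] {X X' : Scheme.{u}} {α : X ⟶ Spec (CommRingCat.of k)}
  {α' : X' ⟶ Spec (CommRingCat.of k')} {φ : X' ⟶ X}
  (hφ : IsElementalExtension p (algebraMap k l) (algebraMap l k') α α' φ)
  (h : φ ≫ α = α' ≫ specMap (algebraMap k k'))

include hφ

lemma isNormalization_baseChange [IsIntegral (ElementalExt.baseChange k₁ (φ ≫ α))]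
    (hY : IsNormal (ElementalExt.baseChange k₁ (φ ≫ α)))
    {ν₁ : ElementalExt.baseChange k₁ (φ ≫ α) ⟶
      pullback (baseChangeStr k₁ α) (specMap (inclRight (k := k) k₁ l))}
    (h₁ : ν₁ ≫ pullback.fst _ _ = baseChangeMap k₁ α φ)
    (h₂ : ν₁ ≫ pullback.snd _ _ =
      baseChangeTop k₁ (φ ≫ α) α' h ≫ specMap (tensorMap (k := k) k₁ l k')) :
    IsNormalization ν₁ := by
  obtain ⟨g, hg₁, hg₂, sqZ⟩ := exists_isPullback_baseChangeStr k₁ l α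
  obtain ⟨ν, hν, hν₁, hν₂⟩ : ∃ ν : X' ⟶ pullback α (specMap (algebraMap k l)),
      IsNormalization ν ∧ ν ≫ pullback.fst _ _ = φ ∧
        ν ≫ pullback.snd _ _ = α' ≫ specMap (algebraMap l k') :=
    ⟨_, hφ.isNormalization, pullback.lift_fst _ _ _, pullback.lift_snd _ _ _⟩
  have w : ν₁ ≫ g = pullback.fst _ _ ≫ ν := by
    apply pullback.hom_ext
    · rw [Category.assoc, Category.assoc, hg₁, reassoc_of% h₁, hν₁]
      exact pullback.lift_fst _ _ _
    · rw [Category.assoc, Category.assoc, hg₂, reassoc_of% h₂, hν₂,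
        ← reassoc_of% baseChangeTop_comp_algebraMap k₁ h]
      simp only [specMap, ← Spec.map_comp, ← CommRingCat.ofHom_comp, tensorMap_comp_algebraMap]
  refine .of_isPullback hν w sqZ ?_ hY
  rw [reassoc_of% h₁, baseChangeMap_comp_baseChangeStr, ← Category.assoc, hν₁]
  exact .of_hasPullback (φ ≫ α) (specMap (algebraMap k k₁))

theorem baseChange [ExpChar k p] (hk : IsAlgClosedInFunctionField α)
    (hk₁ : IsSeparableExtension k k₁) :
    IsElementalExtension p (inclRight (k := k) k₁ l) (tensorMap (k := k) k₁ l k')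
      (baseChangeStr k₁ α) (baseChangeTop k₁ (φ ≫ α) α' h) (baseChangeMap k₁ α φ) := by
  have := hk.isIntegral
  have := hφ.isNormalization.isIntegral_source
  have hk' : ∀ x : k', x ^ p ∈ (algebraMap k k').range :=
    IsScalarTower.algebraMap_eq k l k' ▸ hφ.pow_mem_range_comp hk.isIntegrallyClosedHom
  have hl₁ := hk₁.isField_tensorProduct p hφ.pow_mem_range
  have hk₁' := hk₁.isField_tensorProduct p hk'
  have hint : (algebraMap k k').IsIntegral :=
    isIntegral_of_forall_pow_mem_range (expChar_ne_zero k p) hk'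
  have : Algebra.IsAlgebraic k k' := ⟨fun x ↦ IsIntegral.isAlgebraic (hint x)⟩
  have := hk₁.isGeometricallyReduced
  have := isGeometricallyReduced_tensorProduct_of_isAlgebraic k k₁ k'
  have sq := isPullback_baseChangeTop k₁ h
  have hα' := hφ.isIntegrallyClosedHom_toFunctionField
  have hX₁' := isIntegral_of_isPullback hk₁' sq hα'
  have hcomm : baseChangeMap k₁ α φ ≫ baseChangeStr k₁ α = baseChangeTop k₁ (φ ≫ α) α' h ≫
      specMap ((tensorMap (k := k) k₁ l k').comp (inclRight (k := k) k₁ l)) := by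
    rw [tensorMap_comp_inclRight, baseChangeTop_comp_inclRight, baseChangeMap_comp_baseChangeStr]
  have hnorm := hφ.isNormalization_baseChange h
    (isNormal_of_isPullback hk₁' sq hα' hφ.isNormalization.isNormal)
    (pullback.lift_fst (baseChangeMap k₁ α φ) (baseChangeTop k₁ (φ ≫ α) α' h ≫
      specMap (tensorMap (k := k) k₁ l k')) (by rw [hcomm]; simp [specMap]))
    (pullback.lift_snd _ _ _)
  have hj : (tensorMap (k := k) k₁ l k').IsIntegral :=
    isIntegral_of_forall_pow_mem_range (expChar_ne_zero k p) (pow_mem_range_tensorMap p hk')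
  refine ⟨hl₁, hk₁', hk₁.isPurelyInseparableHom_inclRight p hφ.pow_mem_range,
    pow_mem_range_inclRight p hφ.pow_mem_range, hnorm.isIntegral_target, hcomm, hnorm, fun x ↦ ?_⟩
  rw [isAlgebraicElem_iff_isIntegralElem hl₁, isIntegralElem_comp_iff hj]
  refine ⟨ElementalExt.isIntegrallyClosedHom_toFunctionField hk₁' sq hα' x, ?_⟩
  rintro ⟨y, rfl⟩
  exact RingHom.isIntegralElem_map _

end IsElementalExtension

end SeparableBaseChange

end ElementalExt

theorem mainTheorem8_general {p : ℕ} {k l k' k₁ : Type u} [Field k] [Field l] [Field k']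
    [Field k₁] [ExpChar k p] [Algebra k l] [Algebra l k'] [Algebra k k'] [IsScalarTower k l k']
    [Algebra k k₁] {X X' : Scheme.{u}} {α : X ⟶ Spec (CommRingCat.of k)}
    {α' : X' ⟶ Spec (CommRingCat.of k')} {φ : X' ⟶ X} (hk : IsAlgClosedInFunctionField α)
    (hφ : IsElementalExtension p (algebraMap k l) (algebraMap l k') α α' φ)
    (hk₁ : IsSeparableExtension k k₁) :
    ((IsVariety α → IsVariety (baseChangeStr k₁ α)) ∧
      IsAlgClosedInFunctionField (baseChangeStr k₁ α) ∧
      (IsNormal X → IsNormal (baseChange k₁ α))) ∧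
    (IsField (l ⊗[k] k₁) ∧ IsField (k' ⊗[k] k₁) ∧
      IsPurelyInseparableHom (inclRight (k := k) k₁ l) ∧
      IsPurelyInseparableHom (tensorMap (k := k) k₁ l k') ∧
      IsPurelyInseparableHom (inclRight (k := k) k₁ k') ∧
      ∀ x : k' ⊗[k] k₁, x ^ p ∈ (inclRight (k := k) k₁ k').range) ∧
    (degree (inclRight (k := k) k₁ l) = Module.rank k l ∧
      degree (tensorMap (k := k) k₁ l k') = Module.rank l k' ∧
      degree (inclRight (k := k) k₁ k') = Module.rank k k') ∧
    IsElementalExtension p (inclRight (k := k) k₁ l) (tensorMap (k := k) k₁ l k')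
      (baseChangeStr k₁ α)
      (baseChangeTop k₁ (φ ≫ α) α'
        (hφ.comm.trans (by rw [IsScalarTower.algebraMap_eq k l k'])))
      (baseChangeMap k₁ α φ) := by
  have := hk.isIntegral
  have hl := hφ.pow_mem_range
  have hk' : ∀ x : k', x ^ p ∈ (algebraMap k k').range :=
    IsScalarTower.algebraMap_eq k l k' ▸ hφ.pow_mem_range_comp hk.isIntegrallyClosedHom
  exact ⟨⟨fun hX ↦ hX.baseChange hk hk₁, hk.baseChange hk₁, fun hX ↦ hX.baseChange hk hk₁⟩,
    ⟨hk₁.isField_tensorProduct p hl, hk₁.isField_tensorProduct p hk',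
      hk₁.isPurelyInseparableHom_inclRight p hl, hk₁.isPurelyInseparableHom_tensorMap p hl hk',
      hk₁.isPurelyInseparableHom_inclRight p hk', pow_mem_range_inclRight p hk'⟩,
    ⟨degree_inclRight l k₁, degree_tensorMap l k' k₁, degree_inclRight k' k₁⟩,
    hφ.baseChange _ hk hk₁⟩

theorem mainTheorem8 (p : ℕ) [Fact p.Prime]
    (k l k' k₁ : Type u) [Field k] [Field l] [Field k'] [Field k₁] [CharP k p]
    [Algebra k l] [Algebra l k'] [Algebra k k'] [IsScalarTower k l k'] [Algebra k k₁]
    (X X' : Scheme.{u}) (α : X ⟶ Spec (CommRingCat.of k)) (α' : X' ⟶ Spec (CommRingCat.of k'))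
    (φ : X' ⟶ X)
    (hX : IsVariety α) (hk : IsAlgClosedInFunctionField α)
    (hφ : IsElementalExtension p (algebraMap k l) (algebraMap l k') α α' φ)
    (hk₁ : IsSeparableExtension k k₁) :
    (IsVariety (baseChangeStr k₁ α) ∧ IsAlgClosedInFunctionField (baseChangeStr k₁ α) ∧
      (IsNormal X → IsNormal (baseChange k₁ α))) ∧
    (IsField (l ⊗[k] k₁) ∧ IsField (k' ⊗[k] k₁) ∧
      IsPurelyInseparableHom (inclRight (k := k) k₁ l) ∧
      IsPurelyInseparableHom (tensorMap (k := k) k₁ l k') ∧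
      IsPurelyInseparableHom (inclRight (k := k) k₁ k') ∧
      ∀ x : k' ⊗[k] k₁, x ^ p ∈ (inclRight (k := k) k₁ k').range) ∧
    (degree (inclRight (k := k) k₁ l) = Module.rank k l ∧
      degree (tensorMap (k := k) k₁ l k') = Module.rank l k' ∧
      degree (inclRight (k := k) k₁ k') = Module.rank k k') ∧
    IsElementalExtension p (inclRight (k := k) k₁ l) (tensorMap (k := k) k₁ l k')
      (baseChangeStr k₁ α)
      (baseChangeTop k₁ (φ ≫ α) α'
        (hφ.comm.trans (by rw [IsScalarTower.algebraMap_eq k l k'])))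
      (baseChangeMap k₁ α φ) := by
  have : ExpChar k p := .prime Fact.out
  obtain ⟨⟨h₁, h₂⟩, h₃⟩ := mainTheorem8_general hk hφ hk₁
  exact ⟨⟨h₁ hX, h₂⟩, h₃⟩
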